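/- **Model.** Algorithms are uniform programs of a random access machine over the field. Field operations, equality tests in the field, additions, subtractions and comparisons of natural-number registers, memory accesses, loop iterations, black-box queries and random draws take one step each. The only field constants in a program are $0$ and $1$. The same programs and the same exponent $c$ serve for all fields $\mathbb{F}$ and all inputs. "Black-box access to $f$" means that $f$ can be evaluated at any point of $\mathbb{F}^n$ in one step. A rank-one matrix is one of rank exactly $1$. $Y=\mathrm{diag}(y_1,\dots,y_n)$ and $Z=\mathrm{diag}(z_1,\dots,z_n)$ are diagonal matrices of variables, and equalities of determinants are equalities of polynomials. **Theorem (learning read-once determinants and black-box principal minor assignment are equivalent under randomized polynomial-time reductions).** There are programs $P$ (preprocessing), $E$ (evaluation), $R$ (recovery) and $Q$, and a constant $c$, with the following properties. 1. *(From $\det(A_0+\sum_i A_iy_i)$ to $\det(A+Z)$.)* Let $n\ge 1$ and $r,k\ge 0$ be integers, let $|\mathbb{F}|>n+1$, and let $S$ be a list of $n+2$ distinct elements of $\mathbb{F}$. Let $f=\det(A_0+\sum_{i=1}^n A_iy_i)$ with $A_0,\dots,A_n\in\mathbb{F}^{r\times r}$ and $A_1,\dots,A_n$ of rank one; if $n=1$,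 assume that $f$ is not constant. The program $P$ is given $n$, $k$, $S$, black-box access to $f$ (but neither $r$ nor the $A_i$), and random elements drawn independently and uniformly from $S$. It always stops within $(n+k+2)^c$ steps, and with probability at least $1-2^{-k}$ it leaves a memory state $\sigma$ for which there is a matrix $A\in\mathbb{F}^{n\times n}$ such that: - started on $\sigma$ with any point $z\in\mathbb{F}^n$, and with black-box access to $f$, the deterministic program $E$ outputs the value of $\det(A+Z)$ at $z$; - started on $\sigma$ with any $A'\in\mathbb{F}^{n\times n}$ such that $\det(A'+Z)=\det(A+Z)$, the deterministic program $R$, which makes no use of a black box, outputs $B_0,\dots,B_n\in\mathbb{F}^{n\times n}$ with $B_1,\dots,B_n$ of rank one and $f=\det(B_0+\sum_{i=1}^n B_iy_i)$. For every outcome of the random draws, $E$ (on every $z$) and $R$ (on every $A'$) stop within $(n+2)^c$ steps. 2. *(From $\det(A+Y)$ to $\det(B_0+\sum_i B_iy_i)$.)* Let $\mathbb{F}$ be any field, $n\ge 0$ and $A\in\mathbb{F}^{n\times n}$. Then $\det(A+Y)$ is itself of the form $\det(B_0+\sum_{i=1}^n B_iy_i)$ with $B_0,\dots,B_n\in\mathbb{F}^{n\times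 n}$ and $B_1,\dots,B_n$ of rank one. Moreover, for any $r\ge 0$ and any $B_0,\dots,B_n\in\mathbb{F}^{r\times r}$ with $B_1,\dots,B_n$ of rank one and $\det(A+Y)=\det(B_0+\sum_{i=1}^n B_iy_i)$, the deterministic program $Q$, given $n$, $r$ and $B_0,\dots,B_n$, outputs within $(n+r+2)^c$ steps a matrix $A'\in\mathbb{F}^{n\times n}$ with $\det(A'+Y)=\det(A+Y)$. -/

import Mathlib

/-!
The model of computation: a random access machine over a field.  It has registers that hold
natural numbers, an unbounded memory of field elements, access to a black box `(ℕ → F) → F`, and a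
source of random field elements.  Programs are built from assignments, tests and counting loops;
they contain no field constants besides `0` and `1`, so one program runs over every field.  Every
arithmetic operation, memory access, test, loop iteration, random draw and black-box query is
charged.
-/

namespace FieldRAM

/-- Expressions of type `ℕ` over the registers (subtraction is truncated). -/
inductive NExp : Type where
  | const (c : ℕ) : NExp
  | reg (x : ℕ) : NExp
  | add (a b : NExp) : NExp
  | sub (a b : NExp) : NExp

/-- Field expressions.  `cell a i j k` is entry `(i, j, k)` of the array `a`. -/
inductive FExp : Type where
  | zero : FExp
  | one : FExp
  | cell (a : ℕ) (i j k : NExp) : FExp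
  | add (p q : FExp) : FExp
  | sub (p q : FExp) : FExp
  | mul (p q : FExp) : FExp
  | div (p q : FExp) : FExp

/-- Tests. -/
inductive Test : Type where
  | natLt (a b : NExp) : Test
  | natEq (a b : NExp) : Test
  | fieldEq (p q : FExp) : Test

/-- Programs. -/
inductive Prog : Type where
  | skip : Prog
  /-- register `x` := `e` -/
  | setReg (x : ℕ) (e : NExp) : Prog
  /-- entry `(i, j, k)` of array `a` := `e` -/
  | setCell (a : ℕ) (i j k : NExp) (e : FExp) : Prog
  /-- entry `(i, j, k)` of array `a` := answer of the black box at the point whose coordinates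
  stand in the entries `(0, 0, 0), (1, 0, 0), (2, 0, 0), …` of array `b` -/
  | query (a : ℕ) (i j k : NExp) (b : ℕ) : Prog
  /-- entry `(i, j, k)` of array `a` := the next random field element -/
  | draw (a : ℕ) (i j k : NExp) : Prog
  | seq (p q : Prog) : Prog
  | ite (t : Test) (p q : Prog) : Prog
  /-- `for x = 0, …, e - 1 do p`, where `e` is evaluated once, on entry -/
  | loop (x : ℕ) (e : NExp) (p : Prog) : Prog

/-- Contents of the registers and of the field memory. -/
structure Store (F : Type*) where
  reg : ℕ → ℕ
  cell : ℕ → ℕ → ℕ → ℕ → F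

/-- A store with the number of random elements drawn and the number of steps made so far. -/
structure Config (F : Type*) extends Store F where
  draws : ℕ
  steps : ℕ

def NExp.size : NExp → ℕ
  | .const _ => 1
  | .reg _ => 1
  | .add a b => a.size + b.size + 1
  | .sub a b => a.size + b.size + 1

def FExp.size : FExp → ℕ
  | .zero => 1
  | .one => 1
  | .cell _ i j k => i.size + j.size + k.size + 1
  | .add p q => p.size + q.size + 1
  | .sub p q => p.size + q.size + 1
  | .mul p q => p.size + q.size + 1
  | .div p q => p.size + q.size + 1

def Test.size : Test → ℕ
  | .natLt a b => a.size + b.size + 1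
  | .natEq a b => a.size + b.size + 1
  | .fieldEq p q => p.size + q.size + 1

def NExp.val (ρ : ℕ → ℕ) : NExp → ℕ
  | .const c => c
  | .reg x => ρ x
  | .add a b => a.val ρ + b.val ρ
  | .sub a b => a.val ρ - b.val ρ

/-- Division by zero yields zero. -/
def FExp.val {F : Type*} [Field F] (s : Store F) : FExp → F
  | .zero => 0
  | .one => 1
  | .cell a i j k => s.cell a (i.val s.reg) (j.val s.reg) (k.val s.reg)
  | .add p q => p.val s + q.val s
  | .sub p q => p.val s - q.val s
  | .mul p q => p.val s * q.val s
  | .div p q => p.val s / q.val s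

def Test.val {F : Type*} [Field F] [DecidableEq F] (s : Store F) : Test → Bool
  | .natLt a b => decide (a.val s.reg < b.val s.reg)
  | .natEq a b => decide (a.val s.reg = b.val s.reg)
  | .fieldEq p q => decide (p.val s = q.val s)

def Store.setReg {F : Type*} (s : Store F) (x v : ℕ) : Store F :=
  { s with reg := fun y => if y = x then v else s.reg y }

def Store.setCell {F : Type*} (s : Store F) (a i j k : ℕ) (v : F) : Store F :=
  { s with cell := fun a' i' j' k' =>
      if a' = a ∧ i' = i ∧ j' = j ∧ k' = k then v else s.cell a' i' j' k' }

/-- Replace the whole array `a` by `g`. -/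
def Store.load {F : Type*} (s : Store F) (a : ℕ) (g : ℕ → ℕ → ℕ → F) : Store F :=
  { s with cell := fun a' => if a' = a then g else s.cell a' }

/-- `exec O ω p s` is the configuration in which `p` ends when started in `s`, with black box `O`
and random elements `ω 0, ω 1, …`. -/
def exec {F : Type*} [Field F] [DecidableEq F] (O : (ℕ → F) → F) (ω : ℕ → F) :
    Prog → Config F → Config F
  | .skip => fun s => { s with steps := s.steps + 1 }
  | .setReg x e => fun s =>
      { s.toStore.setReg x (e.val s.reg) with
        draws := s.draws
        steps := s.steps + (1 + e.size) }
  | .setCell a i j k e => fun s =>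
      { s.toStore.setCell a (i.val s.reg) (j.val s.reg) (k.val s.reg) (e.val s.toStore) with
        draws := s.draws
        steps := s.steps + (1 + i.size + j.size + k.size + e.size) }
  | .query a i j k b => fun s =>
      { s.toStore.setCell a (i.val s.reg) (j.val s.reg) (k.val s.reg)
          (O fun l => s.cell b l 0 0) with
        draws := s.draws
        steps := s.steps + (1 + i.size + j.size + k.size) }
  | .draw a i j k => fun s =>
      { s.toStore.setCell a (i.val s.reg) (j.val s.reg) (k.val s.reg) (ω s.draws) with
        draws := s.draws + 1
        steps := s.steps + (1 + i.size + j.size + k.size) }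
  | .seq p q => fun s => exec O ω q (exec O ω p s)
  | .ite t p q => fun s =>
      let s' : Config F := { s with steps := s.steps + (1 + t.size) }
      if t.val s.toStore then exec O ω p s' else exec O ω q s'
  | .loop x e p => fun s =>
      (List.range (e.val s.reg)).foldl
        (fun s' i => exec O ω p
          { s'.toStore.setReg x i with draws := s'.draws, steps := s'.steps + 1 })
        { s with steps := s.steps + (1 + e.size) }

/-- Run a randomized program, with black box `O` and random elements `ω`. -/
def run {F : Type*} [Field F] [DecidableEq F] (O : (ℕ → F) → F) (ω : ℕ → F) (p : Prog)
    (s : Store F) : Config F :=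
  exec O ω p { s with draws := 0, steps := 0 }

/-- Run a program deterministically: there is no source of randomness, all draws are `0`. -/
def runDet {F : Type*} [Field F] [DecidableEq F] (O : (ℕ → F) → F) (p : Prog)
    (s : Store F) : Config F :=
  run O (fun _ => 0) p s

/-- The black box of a program that has no black box: all its answers are `0`. -/
def noBox {F : Type*} [Field F] : (ℕ → F) → F := fun _ => 0

/-- The black box for an `n`-variate polynomial. -/
noncomputable def boxOf {F : Type*} [Field F] {n : ℕ} (f : MvPolynomial (Fin n) F) :
    (ℕ → F) → F :=
  fun v => MvPolynomial.eval (fun i : Fin n => v i) f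

/-- The empty store, except for two registers. -/
def blank {F : Type*} [Field F] (n k : ℕ) : Store F where
  reg := fun x => if x = 0 then n else if x = 1 then k else 0
  cell := fun _ _ _ _ => 0

/-- A vector as the contents of an array, at the entries `(i, 0, 0)`. -/
def vecArray {F : Type*} [Field F] {m : ℕ} (v : Fin m → F) : ℕ → ℕ → ℕ → F :=
  fun i j k => if h : i < m then (if j = 0 ∧ k = 0 then v ⟨i, h⟩ else 0) else 0

/-- A matrix as the contents of an array, at the entries `(i, j, 0)`. -/
def matArray {F : Type*} [Field F] {m : ℕ} (A : Matrix (Fin m) (Fin m) F) : ℕ → ℕ → ℕ → F :=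
  fun i j k =>
    if h : i < m ∧ j < m then (if k = 0 then A ⟨i, h.1⟩ ⟨j, h.2⟩ else 0) else 0

/-- The matrices `B₀, B₁, …, Bₙ` as the contents of an array: entry `(l, i, j)` is `(B_l) i j`.
The matrix `B₀` is a separate argument, and `B_{l+1}` is `B l` for `l : Fin n`. -/
def tupleArray {F : Type*} [Field F] {n r : ℕ} (B₀ : Matrix (Fin r) (Fin r) F)
    (B : Fin n → Matrix (Fin r) (Fin r) F) : ℕ → ℕ → ℕ → F :=
  fun l i j =>
    if h : l < n + 1 ∧ i < r ∧ j < r then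
      (Fin.cons B₀ B : Fin (n + 1) → Matrix (Fin r) (Fin r) F) ⟨l, h.1⟩ ⟨i, h.2.1⟩ ⟨j, h.2.2⟩
    else 0

/-- Read an `m × m` matrix from the entries `(i, j, 0)` of array `a`. -/
def Store.readMat {F : Type*} (s : Store F) (a m : ℕ) : Matrix (Fin m) (Fin m) F :=
  fun i j => s.cell a i j 0

/-- Read an `m × m` matrix from the entries `(l, i, j)` of array `a`, for a fixed `l`. -/
def Store.readSlice {F : Type*} (s : Store F) (a l m : ℕ) : Matrix (Fin m) (Fin m) F :=
  fun i j => s.cell a l i j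

/-- `m` random elements, as a sequence that continues with `0`. -/
def tape {F : Type*} [Field F] {m : ℕ} (ω : Fin m → F) : ℕ → F :=
  fun i => if h : i < m then ω ⟨i, h⟩ else 0

/-- The probability of `E` when `m` elements are drawn independently and uniformly from
the distinct field elements `S 0, …, S (N - 1)`. -/
noncomputable def drawProb {F : Type*} {N : ℕ} (S : Fin N ↪ F) (m : ℕ)
    (E : (Fin m → F) → Prop) : ℝ :=
  (Nat.card {w : Fin m → Fin N // E (fun i => S (w i))} : ℝ) / (N : ℝ) ^ m

end FieldRAM

/-- The polynomial `det (A₀ + ∑ i, Aᵢ yᵢ)`. -/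
noncomputable def symbolicDet {F : Type*} [Field F] {n r : ℕ} (A₀ : Matrix (Fin r) (Fin r) F)
    (A : Fin n → Matrix (Fin r) (Fin r) F) : MvPolynomial (Fin n) F :=
  (A₀.map MvPolynomial.C +
    ∑ i, (MvPolynomial.X i : MvPolynomial (Fin n) F) • (A i).map MvPolynomial.C).det

/-- The polynomial `det (A + Y)` with `Y = diag (y₁, …, yₙ)`. -/
noncomputable def diagonalDet {F : Type*} [Field F] {n : ℕ} (A : Matrix (Fin n) (Fin n) F) :
    MvPolynomial (Fin n) F :=
  (A.map MvPolynomial.C + Matrix.diagonal MvPolynomial.X).det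

open FieldRAM in
/-- The store `s` is a correct result of preprocessing `f`.  There is an `n × n` matrix `A` such
that `evalP`, started on `s` with a point `z` in array `1`, and with the black box for `f`, leaves
the value of `det (A + Z)` at `z` in array `2`; and for every `A'` with
`det (A' + Z) = det (A + Z)`, the program `recP`, started on `s` with `A'` in array `1`, leaves in
array `2` matrices `B₀, …, Bₙ` of size `n × n` with `f = det (B₀ + ∑ i, Bᵢ yᵢ)` and
`B₁, …, Bₙ` of rank one. -/
def GoodPreprocessing {F : Type*} [Field F] [DecidableEq F] {n : ℕ} (evalP recP : Prog)
    (f : MvPolynomial (Fin n) F) (s : Store F) : Prop :=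
  ∃ A : Matrix (Fin n) (Fin n) F,
    (∀ z : Fin n → F,
      (runDet (boxOf f) evalP (s.load 1 (vecArray z))).cell 2 0 0 0 =
        MvPolynomial.eval z (diagonalDet A)) ∧
    ∀ A' : Matrix (Fin n) (Fin n) F, diagonalDet A' = diagonalDet A →
      let t := (runDet noBox recP (s.load 1 (matArray A'))).toStore
      (∀ i : Fin n, (t.readSlice 2 (i + 1) n).rank = 1) ∧
        f = symbolicDet (t.readSlice 2 0 n) (fun i : Fin n => t.readSlice 2 (i + 1) n)

/-! From representations to det(A + Z). Rank-one matrices are outer products, so f = det(A₀ + U Y V)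
with Y diagonal, and a Schur complement bounds the degree of f by n, whatever r is
(`totalDegree_symbolicDet_le`). At a point a with f(a) ≠ 0 the matrix determinant lemma gives f(a +
y) = f(a) det(1 + Y M), where M = V B⁻¹ U and B = A₀ + U diag(a) V (`exists_aeval_symbolicDet_eq`).
The polynomials det(1 + Y M) and det(M + Z) determine each other through y = 1/z. At points z with
zero coordinates, det(M + Z) is the coefficient of sⁿ in det(s(M + Z) + E), where E marks the zero
coordinates; it is interpolated from n + 1 values of f (`det_add_diagonal_eq_sum`).

The point a is found at random. By Schwartz–Zippel a trial fails with probability at most n/(n+2),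
hence n + 2 trials fail together with probability at most 1/2, and k such batches with probability
at most 2⁻ᵏ (`le_drawProb_prepProg`). If every trial fails, the programs proceed as if f = 0.

For recovery, A' has the same reversed polynomial as M, so f = f(a) det(1 + (Y - diag a) A'), which
is linear in each y_l with matrix e_l times row l of A'. A zero row would give rank zero; it
receives instead an outer product of unit vectors that amounts to a left factor of determinant one
(`det_one_sub_add_sum_eq`). Scaling one column absorbs f(a).

Conversely, let det(A + Y) = det(B₀ + U Y V) and border B₀ to N = [[B₀, U], [-V, 0]]. Reversal shows
det(N + diag(0, X)) = det(1 + X A). Thus det N = 1, and the lower right block of N⁻¹ has the same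
polynomial as A (`diagonalDet_toBlocks₂₂_eq`). The program factors the rank-one matrices and inverts
N by Gauss–Jordan elimination.

Running times are read off from the syntax (`exec_steps_le`); correctness uses weakest preconditions
with a frame rule. -/

/-! ### Frames, running times and weakest preconditions for programs -/

namespace FieldRAM

/-- The registers that a program may write. -/
def Prog.regs : Prog → List ℕ
  | .setReg x _ => [x]
  | .seq p q => p.regs ++ q.regs
  | .ite _ p q => p.regs ++ q.regs
  | .loop x _ p => x :: p.regs
  | _ => []

/-- The arrays that a program may write. -/
def Prog.arrays : Prog → List ℕ
  | .setCell a _ _ _ _ => [a]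
  | .query a _ _ _ _ => [a]
  | .draw a _ _ _ => [a]
  | .seq p q => p.arrays ++ q.arrays
  | .ite _ p q => p.arrays ++ q.arrays
  | .loop _ _ p => p.arrays
  | _ => []

/-- Two stores agree outside of the registers and arrays that `p` may write. -/
structure Agree {F : Type*} (p : Prog) (s s' : Store F) : Prop where
  reg : ∀ x, x ∉ p.regs → s'.reg x = s.reg x
  cell : ∀ a, a ∉ p.arrays → s'.cell a = s.cell a

theorem foldl_range_induction {α : Type*} {f : α → ℕ → α} {P : ℕ → α → Prop} {a : α} {n : ℕ}
    (h0 : P 0 a) (hs : ∀ i < n, ∀ a, P i a → P (i + 1) (f a i)) :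
    P n ((List.range n).foldl f a) := by
  induction n with
  | zero => simpa using h0
  | succ n ih =>
    rw [List.range_succ, List.foldl_append]
    exact hs n (Nat.lt_succ_self n) _ (ih fun i hi => hs i (hi.trans (Nat.lt_succ_self n)))

section

variable {F : Type*}

theorem Agree.refl (p : Prog) (s : Store F) : Agree p s s := ⟨fun _ _ => rfl, fun _ _ => rfl⟩

theorem Agree.trans {p : Prog} {s t u : Store F} (h : Agree p s t) (h' : Agree p t u) :
    Agree p s u :=
  ⟨fun x hx => (h'.reg x hx).trans (h.reg x hx), fun a ha => (h'.cell a ha).trans (h.cell a ha)⟩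

theorem Agree.mono {p q : Prog} {s t : Store F} (h : Agree p s t) (hr : p.regs ⊆ q.regs)
    (ha : p.arrays ⊆ q.arrays) : Agree q s t :=
  ⟨fun x hx => h.reg x fun h' => hx (hr h'), fun a hx => h.cell a fun h' => hx (ha h')⟩

variable [Field F] [DecidableEq F] {O : (ℕ → F) → F} {ω : ℕ → F}

/-- The frame property. It lets loop invariants mention only what changes; everything else is
recovered by deciding membership in `regs` or `arrays`. -/
theorem exec_agree (p : Prog) (s : Config F) : Agree p s.toStore (exec O ω p s).toStore := by
  induction p generalizing s with
  | skip => exact ⟨fun _ _ => rfl, fun _ _ => rfl⟩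
  | setReg x e =>
    refine ⟨fun y hy => ?_, fun _ _ => rfl⟩
    simp only [Prog.regs, List.mem_singleton] at hy
    simp [exec, Store.setReg, hy]
  | setCell a i j k e =>
    refine ⟨fun y hy => rfl, fun b hb => ?_⟩
    simp only [Prog.arrays, List.mem_singleton] at hb
    simp [exec, Store.setCell, hb]
  | query a i j k b =>
    refine ⟨fun y hy => rfl, fun b hb => ?_⟩
    simp only [Prog.arrays, List.mem_singleton] at hb
    simp [exec, Store.setCell, hb]
  | draw a i j k =>
    refine ⟨fun y hy => rfl, fun b hb => ?_⟩
    simp only [Prog.arrays, List.mem_singleton] at hb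
    simp [exec, Store.setCell, hb]
  | seq p q hp hq =>
    exact ((hp s).mono (List.subset_append_left _ _) (List.subset_append_left _ _)).trans
      ((hq _).mono (List.subset_append_right _ _) (List.subset_append_right _ _))
  | ite t p q hp hq =>
    simp only [exec]
    split
    · exact (hp { s with steps := s.steps + (1 + t.size) }).mono
        (List.subset_append_left _ _) (List.subset_append_left _ _)
    · exact (hq { s with steps := s.steps + (1 + t.size) }).mono
        (List.subset_append_right _ _) (List.subset_append_right _ _)
  | loop x e p hp =>
    refine foldl_range_induction (P := fun _ (t : Config F) => Agree (.loop x e p) s.toStore t.toStore)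
      (Agree.refl _ _) fun i _ t ht => ht.trans ?_
    have h := (hp { t.toStore.setReg x i with draws := t.draws, steps := t.steps + 1 }).mono
      (q := .loop x e p) (List.subset_cons_self _ _) (List.Subset.refl _)
    refine ⟨fun y hy => ?_, fun a ha => h.cell a ha⟩
    have hyx : y ≠ x := fun h' => hy (by simp [Prog.regs, h'])
    rw [h.reg y hy]
    simp [Store.setReg, hyx]

/-! ### Polynomial running times from syntax -/

/-- The expression reads only registers below `m`. -/
def NExp.closed (m : ℕ) : NExp → Bool
  | .const _ => true
  | .reg x => decide (x < m)
  | .add a b => a.closed m && b.closed m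
  | .sub a b => a.closed m && b.closed m

/-- The program never writes a register below `m`, and its loop bounds read only such registers. -/
def Prog.tame (m : ℕ) : Prog → Bool
  | .setReg x _ => decide (m ≤ x)
  | .seq p q => p.tame m && q.tame m
  | .ite _ p q => p.tame m && q.tame m
  | .loop x e p => decide (m ≤ x) && (e.closed m && p.tame m)
  | _ => true

/-- An exponent for the value when the registers read are at most N ≥ 2; a constant c is covered by
c ≤ N ^ c, and truncated subtraction only decreases. -/
def NExp.deg : NExp → ℕ
  | .const c => c
  | .reg _ => 1
  | .add a b => a.deg + b.deg + 1
  | .sub a _ => a.deg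

/-- An exponent for a polynomial bound of the running time of a tame program. -/
def Prog.deg : Prog → ℕ
  | .skip => 0
  | .setReg _ e => 1 + e.size
  | .setCell _ i j k e => 1 + i.size + j.size + k.size + e.size
  | .query _ i j k _ => 1 + i.size + j.size + k.size
  | .draw _ i j k => 1 + i.size + j.size + k.size
  | .seq p q => p.deg + q.deg + 1
  | .ite t p q => 1 + t.size + (p.deg + q.deg) + 1
  | .loop _ e p => 1 + e.size + (e.deg + (p.deg + 1)) + 1

theorem le_pow_self_of_two_le {N : ℕ} (hN : 2 ≤ N) (c : ℕ) : c ≤ N ^ c :=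
  (Nat.lt_pow_self (by omega)).le

theorem pow_add_pow_le {N : ℕ} (hN : 2 ≤ N) (a b : ℕ) : N ^ a + N ^ b ≤ N ^ (a + b + 1) := by
  have h1 : N ^ a ≤ N ^ (a + b) := Nat.pow_le_pow_right (by omega) (by omega)
  have h2 : N ^ b ≤ N ^ (a + b) := Nat.pow_le_pow_right (by omega) (by omega)
  have h3 := Nat.mul_le_mul_left (N ^ (a + b)) hN
  rw [pow_succ]
  omega

theorem NExp.val_le {m N : ℕ} (hN : 2 ≤ N) {ρ : ℕ → ℕ} (hρ : ∀ x < m, ρ x ≤ N) (e : NExp)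
    (he : e.closed m = true) : e.val ρ ≤ N ^ e.deg := by
  induction e with
  | const c => exact le_pow_self_of_two_le hN c
  | reg x => simpa [NExp.val, NExp.deg] using hρ x (by simpa [NExp.closed] using he)
  | add a b ha hb =>
    simp only [NExp.closed, Bool.and_eq_true] at he
    exact (add_le_add (ha he.1) (hb he.2)).trans (pow_add_pow_le hN _ _)
  | sub a b ha hb =>
    simp only [NExp.closed, Bool.and_eq_true] at he
    exact (Nat.sub_le _ _).trans (ha he.1)

theorem Prog.le_of_mem_regs {m : ℕ} (p : Prog) (hp : p.tame m = true) : ∀ x ∈ p.regs, m ≤ x := by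
  induction p with
  | setReg x e => simpa [Prog.regs, Prog.tame] using hp
  | seq p q hp' hq' =>
    simp only [Prog.tame, Bool.and_eq_true] at hp
    simp only [Prog.regs, List.mem_append]
    rintro x (h | h)
    exacts [hp' hp.1 x h, hq' hp.2 x h]
  | ite t p q hp' hq' =>
    simp only [Prog.tame, Bool.and_eq_true] at hp
    simp only [Prog.regs, List.mem_append]
    rintro x (h | h)
    exacts [hp' hp.1 x h, hq' hp.2 x h]
  | loop x e p hp' =>
    simp only [Prog.tame, Bool.and_eq_true, decide_eq_true_eq] at hp
    simp only [Prog.regs, List.mem_cons]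
    rintro y (rfl | h)
    exacts [hp.1, hp' hp.2.2 y h]
  | _ => simp [Prog.regs]

/-- Loop bounds depend only on registers below m, which never change, so each loop makes at most N
to a fixed power rounds. Sums of costs fit into one power because N ^ a + N ^ b ≤ N ^ (a + b + 1)
for N ≥ 2. -/
theorem exec_steps_le {m N : ℕ} (hN : 2 ≤ N) (p : Prog) (hp : p.tame m = true) (s : Config F)
    (hs : ∀ x < m, s.reg x ≤ N) : (exec O ω p s).steps ≤ s.steps + N ^ p.deg := by
  induction p generalizing s with
  | skip => simp [exec, Prog.deg]
  | setReg x e => exact Nat.add_le_add_left (le_pow_self_of_two_le hN _) _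
  | setCell a i j k e => exact Nat.add_le_add_left (le_pow_self_of_two_le hN _) _
  | query a i j k b => exact Nat.add_le_add_left (le_pow_self_of_two_le hN _) _
  | draw a i j k => exact Nat.add_le_add_left (le_pow_self_of_two_le hN _) _
  | seq p q hp' hq' =>
    simp only [Prog.tame, Bool.and_eq_true] at hp
    have h1 := hp' hp.1 s hs
    have h2 := hq' hp.2 (exec O ω p s) fun x hx => by
      rw [(exec_agree p s).reg x fun h => absurd (p.le_of_mem_regs hp.1 x h) (by omega)]
      exact hs x hx
    have h3 := pow_add_pow_le hN p.deg q.deg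
    simp only [exec, Prog.deg]
    omega
  | ite t p q hp' hq' =>
    simp only [Prog.tame, Bool.and_eq_true] at hp
    have h0 := le_pow_self_of_two_le hN (1 + t.size)
    have h3 : N ^ p.deg ≤ N ^ (p.deg + q.deg) := Nat.pow_le_pow_right (by omega) (by omega)
    have h4 : N ^ q.deg ≤ N ^ (p.deg + q.deg) := Nat.pow_le_pow_right (by omega) (by omega)
    have h5 := pow_add_pow_le hN (1 + t.size) (p.deg + q.deg)
    simp only [exec, Prog.deg]
    split
    · have h1 := hp' hp.1 { s with steps := s.steps + (1 + t.size) } hs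
      simp only at h1
      omega
    · have h1 := hq' hp.2 { s with steps := s.steps + (1 + t.size) } hs
      simp only at h1
      omega
  | loop x e p hp' =>
    simp only [Prog.tame, Bool.and_eq_true, decide_eq_true_eq] at hp
    have key := foldl_range_induction (n := e.val s.reg)
      (f := fun (s' : Config F) i => exec O ω p
        { s'.toStore.setReg x i with draws := s'.draws, steps := s'.steps + 1 })
      (P := fun i (t : Config F) => (∀ y < m, t.reg y ≤ N) ∧
        t.steps ≤ s.steps + (1 + e.size) + i * (1 + N ^ p.deg))
      (a := { s with steps := s.steps + (1 + e.size) }) ⟨hs, by simp⟩ (by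
        rintro i - t ⟨h1, h2⟩
        have hreg : ∀ y < m, (t.toStore.setReg x i).reg y ≤ N := fun y hy => by
          have : y ≠ x := by omega
          simpa [Store.setReg, this] using h1 y hy
        refine ⟨fun y hy => ?_, ?_⟩
        · rw [(exec_agree p _).reg y fun h => absurd (p.le_of_mem_regs hp.2.2 y h) (by omega)]
          exact hreg y hy
        · have h3 := hp' hp.2.2
            { t.toStore.setReg x i with draws := t.draws, steps := t.steps + 1 } hreg
          simp only at h3
          rw [add_mul]
          refine h3.trans ?_
          omega)
    have h1 : e.val s.reg * (1 + N ^ p.deg) ≤ N ^ (e.deg + (p.deg + 1)) := by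
      rw [pow_add]
      refine Nat.mul_le_mul (e.val_le hN hs hp.2.1) ?_
      simpa [add_comm] using pow_add_pow_le hN 0 p.deg
    have h2 := le_pow_self_of_two_le hN (1 + e.size)
    have h3 := pow_add_pow_le hN (1 + e.size) (e.deg + (p.deg + 1))
    refine key.2.trans ?_
    simp only [Prog.deg]
    omega

theorem run_steps_le {m N : ℕ} (hN : 2 ≤ N) (p : Prog) (hp : p.tame m = true) (s : Store F)
    (hs : ∀ x < m, s.reg x ≤ N) : (run O ω p s).steps ≤ N ^ p.deg := by
  simpa [run] using exec_steps_le (O := O) (ω := ω) hN p hp { s with draws := 0, steps := 0 } hs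

/-! ### Weakest preconditions -/

/-- The weakest precondition of `p` for the condition `Q` on the store and the number of draws. -/
def wp (O : (ℕ → F) → F) (ω : ℕ → F) (p : Prog) (Q : Store F → ℕ → Prop) (s : Store F) (d : ℕ) :
    Prop :=
  -- The step counter never influences the store, so correctness quantifies over it and is kept
  -- apart from the cost bound.
  ∀ c : ℕ, Q (exec O ω p ⟨s, d, c⟩).toStore (exec O ω p ⟨s, d, c⟩).draws

variable {Q : Store F → ℕ → Prop} {s : Store F} {d : ℕ}

theorem wp.run {p : Prog} (h : wp O ω p Q s 0) : Q (run O ω p s).toStore (run O ω p s).draws :=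
  h 0

theorem wp.mono {p : Prog} {Q' : Store F → ℕ → Prop} (h : wp O ω p Q s d)
    (hQ : ∀ s' d', Agree p s s' → Q s' d' → Q' s' d') : wp O ω p Q' s d :=
  fun c => hQ _ _ (exec_agree p ⟨s, d, c⟩) (h c)

theorem wp_skip : wp O ω .skip Q s d ↔ Q s d := by simp [wp, exec]

theorem wp_setReg {x : ℕ} {e : NExp} :
    wp O ω (.setReg x e) Q s d ↔ Q (s.setReg x (e.val s.reg)) d := by simp [wp, exec]

theorem wp_setCell {a : ℕ} {i j k : NExp} {e : FExp} : wp O ω (.setCell a i j k e) Q s d ↔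
    Q (s.setCell a (i.val s.reg) (j.val s.reg) (k.val s.reg) (e.val s)) d := by simp [wp, exec]

theorem wp_query {a b : ℕ} {i j k : NExp} : wp O ω (.query a i j k b) Q s d ↔
    Q (s.setCell a (i.val s.reg) (j.val s.reg) (k.val s.reg) (O fun l => s.cell b l 0 0)) d := by
  simp [wp, exec]

theorem wp_draw {a : ℕ} {i j k : NExp} : wp O ω (.draw a i j k) Q s d ↔
    Q (s.setCell a (i.val s.reg) (j.val s.reg) (k.val s.reg) (ω d)) (d + 1) := by
  simp [wp, exec]

theorem wp_seq {p q : Prog} (h : wp O ω p (wp O ω q Q) s d) : wp O ω (.seq p q) Q s d :=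
  fun c => h c _

theorem wp_ite {t : Test} {p q : Prog} (hp : t.val s = true → wp O ω p Q s d)
    (hq : t.val s = false → wp O ω q Q s d) : wp O ω (.ite t p q) Q s d := by
  intro c
  simp only [exec]
  split
  · rename_i h
    exact hp h _
  · rename_i h
    exact hq (Bool.eq_false_of_not_eq_true h) _

/-- The invariant is needed on entry to each round, before the loop register is set. Agreement with
the initial store outside the written locations comes for free in both obligations. -/
theorem wp_loop {x : ℕ} {e : NExp} {p : Prog} (I : ℕ → Store F → ℕ → Prop) (h0 : I 0 s d)
    (hs : ∀ i < e.val s.reg, ∀ s' d', Agree (.loop x e p) s s' → I i s' d' →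
      wp O ω p (I (i + 1)) (s'.setReg x i) d')
    (hQ : ∀ s' d', Agree (.loop x e p) s s' → I (e.val s.reg) s' d' → Q s' d') :
    wp O ω (.loop x e p) Q s d := by
  intro c
  have key := foldl_range_induction (n := e.val s.reg)
    (f := fun (s' : Config F) i => exec O ω p
      { s'.toStore.setReg x i with draws := s'.draws, steps := s'.steps + 1 })
    (P := fun i (t : Config F) => Agree (.loop x e p) s t.toStore ∧ I i t.toStore t.draws)
    (a := { toStore := s, draws := d, steps := c + (1 + e.size) }) ⟨Agree.refl _ _, h0⟩ (by
      rintro i hi t ⟨h1, h2⟩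
      refine ⟨h1.trans ?_, hs i hi _ _ h1 h2 _⟩
      have h := (exec_agree (O := O) (ω := ω) p
          { t.toStore.setReg x i with draws := t.draws, steps := t.steps + 1 }).mono
        (q := .loop x e p) (List.subset_cons_self _ _) (List.Subset.refl _)
      refine ⟨fun y hy => ?_, fun a ha => h.cell a ha⟩
      have hyx : y ≠ x := fun h' => hy (by simp [Prog.regs, h'])
      rw [h.reg y hy]
      simp [Store.setReg, hyx])
  exact hQ _ _ key.1 key.2

end

end FieldRAM

section

open Matrix

/-! ### Symbolic determinants -/

theorem exists_eq_vecMulVec_of_rank_eq_one {F : Type*} [Field F] {m n : ℕ}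
    {M : Matrix (Fin m) (Fin n) F} (h : M.rank = 1) : ∃ u v, M = vecMulVec u v := by
  obtain ⟨⟨u, hu⟩, -, hw⟩ := finrank_eq_one_iff'.1 h
  choose v hv using fun j : Fin n => hw ⟨M *ᵥ Pi.single j 1, ⟨_, rfl⟩⟩
  refine ⟨u, v, ?_⟩
  ext i j
  have := congrFun (congrArg Subtype.val (hv j)) i
  simp only [mulVec_single_one] at this
  simpa [vecMulVec_apply, mul_comm] using this.symm

theorem rank_vecMulVec_eq_one {F : Type*} [Field F] {m n : ℕ} {u : Fin m → F} {v : Fin n → F}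
    (hu : u ≠ 0) (hv : v ≠ 0) : (vecMulVec u v).rank = 1 := by
  refine le_antisymm (rank_vecMulVec_le _ _) (Nat.one_le_iff_ne_zero.2 fun h => ?_)
  obtain ⟨i, hi⟩ := Function.ne_iff.1 hu
  obtain ⟨j, hj⟩ := Function.ne_iff.1 hv
  have hmem : vecMulVec u v *ᵥ Pi.single j 1 ∈ (vecMulVec u v).mulVecLin.range := ⟨_, rfl⟩
  rw [Submodule.finrank_eq_zero.1 h, Submodule.mem_bot] at hmem
  have := congrFun hmem i
  simp only [mulVec_single_one, col_apply, vecMulVec_apply, Pi.zero_apply, mul_eq_zero] at this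
  exact this.elim hi hj

theorem exists_factor_of_rank_eq_one {F : Type*} [Field F] {n r : ℕ}
    {A : Fin n → Matrix (Fin r) (Fin r) F} (hA : ∀ i, (A i).rank = 1) :
    ∃ (U : Matrix (Fin r) (Fin n) F) (V : Matrix (Fin n) (Fin r) F),
      A = fun l => vecMulVec (fun i => U i l) (V l) := by
  choose u v h using fun l => exists_eq_vecMulVec_of_rank_eq_one (hA l)
  exact ⟨fun i l => u l i, v, funext h⟩

theorem sum_smul_vecMulVec {R : Type*} [CommRing R] {n r : ℕ} (U : Matrix (Fin r) (Fin n) R)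
    (V : Matrix (Fin n) (Fin r) R) (y : Fin n → R) :
    ∑ l, y l • vecMulVec (fun i => U i l) (V l) = U * diagonal y * V := by
  ext i j
  rw [Matrix.sum_apply, mul_apply]
  simp only [mul_diagonal, Matrix.smul_apply, vecMulVec_apply, smul_eq_mul]
  exact Finset.sum_congr rfl fun _ _ => by ring

section

variable {F : Type*} [Field F] {n r : ℕ}

/-- Arbitrary algebras K are allowed because the same identities are later used over F, over the
fraction field, and over the polynomial ring itself. -/
theorem aeval_symbolicDet {K : Type*} [CommRing K] [Algebra F K] (A₀ : Matrix (Fin r) (Fin r) F)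
    (A : Fin n → Matrix (Fin r) (Fin r) F) (y : Fin n → K) :
    MvPolynomial.aeval y (symbolicDet A₀ A) = (A₀.map (algebraMap F K) +
      ∑ i, y i • (A i).map (algebraMap F K)).det := by
  rw [symbolicDet, AlgHom.map_det]
  congr 1
  ext i j
  simp [Matrix.sum_apply]

theorem aeval_diagonalDet {K : Type*} [CommRing K] [Algebra F K] (A : Matrix (Fin n) (Fin n) F)
    (y : Fin n → K) :
    MvPolynomial.aeval y (diagonalDet A) = (A.map (algebraMap F K) + diagonal y).det := by
  rw [diagonalDet, AlgHom.map_det]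
  congr 1
  ext i j
  by_cases h : i = j <;> simp [h]

theorem eval_symbolicDet (A₀ : Matrix (Fin r) (Fin r) F)
    (A : Fin n → Matrix (Fin r) (Fin r) F) (y : Fin n → F) :
    MvPolynomial.eval y (symbolicDet A₀ A) = (A₀ + ∑ i, y i • A i).det := by
  rw [← MvPolynomial.coe_aeval_eq_eval]
  exact aeval_symbolicDet A₀ A y

theorem eval_diagonalDet (A : Matrix (Fin n) (Fin n) F) (y : Fin n → F) :
    MvPolynomial.eval y (diagonalDet A) = (A + diagonal y).det := by
  rw [← MvPolynomial.coe_aeval_eq_eval]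
  exact aeval_diagonalDet A y

theorem aeval_symbolicDet_vecMulVec {K : Type*} [CommRing K] [Algebra F K]
    (A₀ : Matrix (Fin r) (Fin r) F) (U : Matrix (Fin r) (Fin n) F) (V : Matrix (Fin n) (Fin r) F)
    (y : Fin n → K) :
    MvPolynomial.aeval y (symbolicDet A₀ fun l => vecMulVec (fun i => U i l) (V l)) =
      (A₀.map (algebraMap F K) +
        U.map (algebraMap F K) * diagonal y * V.map (algebraMap F K)).det := by
  rw [aeval_symbolicDet, ← sum_smul_vecMulVec]
  congr 2
  refine Finset.sum_congr rfl fun l _ => ?_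
  ext i j
  simp [vecMulVec_apply]

/-! ### Reversal, expansion around a point, and the bordered matrix -/

/-- Polynomials that agree at all points with nonzero coordinates in extension fields are equal. -/
theorem MvPolynomial.eq_of_aeval_eq {F : Type u} [Field F] {n : ℕ} {p q : MvPolynomial (Fin n) F}
    (h : ∀ (K : Type u) [Field K] [Algebra F K] (x : Fin n → K), (∀ i, x i ≠ 0) →
      aeval x p = aeval x q) : p = q := by
  -- The generic point: the variables themselves, as nonzero elements of the field of rational
  -- functions.
  have key := h (FractionRing (MvPolynomial (Fin n) F))
    (fun i => algebraMap _ _ (X i : MvPolynomial (Fin n) F)) fun i => by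
      simp
  have hX : ∀ p : MvPolynomial (Fin n) F, aeval (fun i => algebraMap (MvPolynomial (Fin n) F)
      (FractionRing (MvPolynomial (Fin n) F)) (X i)) p = algebraMap _ _ p := fun p => by
    simpa [Function.comp_def] using aeval_algebraMap_apply (FractionRing (MvPolynomial (Fin n) F))
      (X : Fin n → MvPolynomial (Fin n) F) p
  rw [hX, hX] at key
  exact IsFractionRing.injective _ _ key

/-- The polynomial `det (1 + Y A)`. -/
noncomputable def reverseDet (A : Matrix (Fin n) (Fin n) F) : MvPolynomial (Fin n) F :=
  (1 + diagonal MvPolynomial.X * A.map MvPolynomial.C).det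

theorem aeval_reverseDet {K : Type*} [CommRing K] [Algebra F K] (A : Matrix (Fin n) (Fin n) F)
    (y : Fin n → K) :
    MvPolynomial.aeval y (reverseDet A) = (1 + diagonal y * A.map (algebraMap F K)).det := by
  rw [reverseDet, AlgHom.map_det]
  congr 1
  ext i j
  simp [diagonal_mul, one_apply, apply_ite]

theorem aeval_reverseDet_eq_prod_mul {K : Type*} [Field K] [Algebra F K]
    (A : Matrix (Fin n) (Fin n) F) {x : Fin n → K} (hx : ∀ i, x i ≠ 0) :
    MvPolynomial.aeval x (reverseDet A) =
      (∏ i, x i) * MvPolynomial.aeval (fun i => (x i)⁻¹) (diagonalDet A) := by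
  rw [aeval_reverseDet, aeval_diagonalDet, ← det_diagonal, ← det_mul, mul_add,
    diagonal_mul_diagonal, add_comm]
  congr 2
  simp [hx]

/-- Inverting all coordinates exchanges the two polynomials up to the factor ∏ xᵢ, and this can be
done at every point without zero coordinates. -/
theorem diagonalDet_eq_iff_reverseDet_eq {A B : Matrix (Fin n) (Fin n) F} :
    diagonalDet A = diagonalDet B ↔ reverseDet A = reverseDet B := by
  constructor <;> intro h <;> refine MvPolynomial.eq_of_aeval_eq fun K _ _ x hx => ?_
  · rw [aeval_reverseDet_eq_prod_mul A hx, aeval_reverseDet_eq_prod_mul B hx, h]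
  · have hx' : ∀ i, (x i)⁻¹ ≠ 0 := fun i => inv_ne_zero (hx i)
    have key := congrArg (MvPolynomial.aeval fun i => (x i)⁻¹) h
    rw [aeval_reverseDet_eq_prod_mul A hx', aeval_reverseDet_eq_prod_mul B hx'] at key
    simpa using mul_left_cancel₀ (Finset.prod_ne_zero_iff.2 fun i _ => hx' i) key

/-- Expansion of `det (A₀ + ∑ Aᵢ yᵢ)` around a point where it does not vanish. -/
theorem exists_aeval_symbolicDet_eq {A₀ : Matrix (Fin r) (Fin r) F}
    {A : Fin n → Matrix (Fin r) (Fin r) F} (hA : ∀ i, (A i).rank = 1) {a : Fin n → F}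
    (ha : MvPolynomial.eval a (symbolicDet A₀ A) ≠ 0) :
    ∃ M : Matrix (Fin n) (Fin n) F, ∀ {K : Type u} [CommRing K] [Algebra F K] (y : Fin n → K),
      MvPolynomial.aeval (fun i => algebraMap F K (a i) + y i) (symbolicDet A₀ A) =
        algebraMap F K (MvPolynomial.eval a (symbolicDet A₀ A)) *
          MvPolynomial.aeval y (reverseDet M) := by
  obtain ⟨U, V, rfl⟩ := exists_factor_of_rank_eq_one hA
  rw [eval_symbolicDet, sum_smul_vecMulVec] at ha ⊢
  set B := A₀ + U * diagonal a * V with hB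
  refine ⟨V * B⁻¹ * U, fun {K} _ _ y => ?_⟩
  set φ := algebraMap F K
  have h1 : A₀.map φ + U.map φ * diagonal (fun i => φ (a i) + y i) * V.map φ =
      B.map φ + U.map φ * (diagonal y * V.map φ) := by
    have : diagonal (fun i => φ (a i)) = (diagonal a).map φ := by simp [diagonal_map]
    rw [← diagonal_add, this, hB, Matrix.map_add _ (map_add φ), Matrix.map_mul, Matrix.map_mul,
      Matrix.mul_add, Matrix.add_mul, add_assoc, Matrix.mul_assoc _ (diagonal y)]
  have hdet : (B.map φ).det = φ B.det := (φ.map_det B).symm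
  have hunit : IsUnit (B.map φ).det := by rw [hdet]; exact (isUnit_iff_ne_zero.2 ha).map φ
  have hinv : (B.map φ)⁻¹ = B⁻¹.map φ := by
    refine inv_eq_left_inv ?_
    rw [← Matrix.map_mul, nonsing_inv_mul _ (isUnit_iff_ne_zero.2 ha),
      Matrix.map_one _ (map_zero φ) (map_one φ)]
  rw [aeval_symbolicDet_vecMulVec, h1, det_add_mul _ _ hunit, hdet, hinv, aeval_reverseDet,
    Matrix.map_mul, Matrix.map_mul, Matrix.mul_assoc, Matrix.mul_assoc, Matrix.mul_assoc]

theorem totalDegree_det_le {m : Type*} [Fintype m] [DecidableEq m]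
    {M : Matrix m m (MvPolynomial (Fin n) F)} {w : m → ℕ}
    (h : ∀ i j, (M i j).totalDegree ≤ w j) : M.det.totalDegree ≤ ∑ j, w j := by
  rw [det_apply]
  refine MvPolynomial.totalDegree_finsetSum_le fun σ _ => ?_
  refine (MvPolynomial.totalDegree_smul_le _ _).trans ?_
  exact (MvPolynomial.totalDegree_finsetProd _ _).trans (Finset.sum_le_sum fun j _ => h _ _)

/-- A Schur complement trades the r × r determinant for that of [[A₀, U Y], [-V, 1]]: its first r
columns are constant and its last n columns have degree at most one. -/
theorem totalDegree_symbolicDet_le {A₀ : Matrix (Fin r) (Fin r) F}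
    {A : Fin n → Matrix (Fin r) (Fin r) F} (hA : ∀ i, (A i).rank = 1) :
    (symbolicDet A₀ A).totalDegree ≤ n := by
  obtain ⟨U, V, rfl⟩ := exists_factor_of_rank_eq_one hA
  have h := aeval_symbolicDet_vecMulVec A₀ U V (MvPolynomial.X : Fin n → MvPolynomial (Fin n) F)
  rw [MvPolynomial.aeval_X_left_apply, ← sub_neg_eq_add, ← Matrix.mul_neg, ← det_fromBlocks_one₂₂] at h
  rw [h]
  refine (totalDegree_det_le (w := Sum.elim (fun _ => 0) fun _ => 1) ?_).trans (by simp)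
  rintro (i | i) (j | j)
  · simp [MvPolynomial.algebraMap_eq]
  · simpa [MvPolynomial.algebraMap_eq] using (MvPolynomial.totalDegree_mul _ _).trans (by simp)
  · simp [MvPolynomial.algebraMap_eq]
  · by_cases h : i = j <;> simp [h, one_apply]

/-- A matrix with prescribed principal minors from the inverse of a bordered matrix. -/
theorem diagonalDet_toBlocks₂₂_eq {A : Matrix (Fin n) (Fin n) F} {B₀ : Matrix (Fin r) (Fin r) F}
    {U : Matrix (Fin r) (Fin n) F} {V : Matrix (Fin n) (Fin r) F}
    (h : diagonalDet A = symbolicDet B₀ fun l => vecMulVec (fun i => U i l) (V l)) :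
    (fromBlocks B₀ U (-V) 0).det = 1 ∧ ∀ R : Matrix (Fin r ⊕ Fin n) (Fin r ⊕ Fin n) F,
      R * fromBlocks B₀ U (-V) 0 = 1 → diagonalDet R.toBlocks₂₂ = diagonalDet A := by
  set C : F →+* MvPolynomial (Fin n) F := MvPolynomial.C
  -- The Schur complement of diag(x) turns the bordered determinant into ∏ xᵢ · det(B₀ + U diag(x)⁻¹
  -- V), which is the reversal of det(A + Y).
  have hg : reverseDet A =
      (fromBlocks (B₀.map C) (U.map C) ((-V).map C) (diagonal MvPolynomial.X)).det := by
    refine MvPolynomial.eq_of_aeval_eq fun K _ _ x hx => ?_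
    set φ := algebraMap F K
    have hblock : (MvPolynomial.aeval x).mapMatrix (fromBlocks (B₀.map C) (U.map C) ((-V).map C)
        (diagonal MvPolynomial.X)) = fromBlocks (B₀.map φ) (U.map φ) ((-V).map φ)
          (diagonal x) := by
      ext (i | i) (j | j)
      · simp [C, φ]
      · simp [C, φ]
      · simp [C, φ]
      · by_cases h : i = j <;> simp [h]
    rw [aeval_reverseDet_eq_prod_mul A hx, h, aeval_symbolicDet_vecMulVec, AlgHom.map_det, hblock]
    have hdx : diagonal x * diagonal (fun i => (x i)⁻¹) = 1 := by
      simp [diagonal_mul_diagonal, hx]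
    let _ : Invertible (diagonal x) := invertibleOfRightInverse _ _ hdx
    have hinv : ⅟(diagonal x) = diagonal fun i => (x i)⁻¹ := invOf_eq_right_inv hdx
    have hneg : (-V).map φ = -(V.map φ) := by ext; simp
    rw [det_fromBlocks₂₂, hinv, det_diagonal, hneg, Matrix.mul_neg, sub_neg_eq_add]
  have hmap : ∀ x : Fin n → F, MvPolynomial.eval x (reverseDet A) =
      (fromBlocks B₀ U (-V) (diagonal x)).det := fun x => by
    rw [hg, RingHom.map_det]
    congr 1
    ext (i | i) (j | j)
    · simp [C]
    · simp [C]
    · simp [C]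
    · by_cases h : i = j <;> simp [h]
  -- At x = 0 the reversed polynomial det(1 + X A) is 1; this is where the invertibility of the
  -- bordered matrix comes from.
  have hdet : (fromBlocks B₀ U (-V) 0).det = 1 := by
    have h0 := hmap 0
    rw [← MvPolynomial.coe_aeval_eq_eval] at h0
    have h1 := aeval_reverseDet A (0 : Fin n → F)
    have h2 : diagonal (0 : Fin n → F) = 0 := diagonal_zero
    rw [h2, Matrix.zero_mul, add_zero, det_one] at h1
    rw [h2] at h0
    exact h0.symm.trans h1
  refine ⟨hdet, fun R hR => diagonalDet_eq_iff_reverseDet_eq.2 ?_⟩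
  have hRdet : R.det = 1 := by
    have := congrArg det hR
    rwa [det_mul, hdet, mul_one, det_one] at this
  have hsplit : fromBlocks (B₀.map C) (U.map C) ((-V).map C) (diagonal MvPolynomial.X) =
      (fromBlocks B₀ U (-V) 0).map C + fromBlocks 0 0 0 (diagonal MvPolynomial.X) := by
    rw [fromBlocks_map, fromBlocks_add]
    simp [C]
  have hRC : (R.map C).det = 1 := by
    have := C.map_det R
    rw [hRdet, map_one] at this
    exact this.symm
  have hRsplit : R.map C = fromBlocks (R.toBlocks₁₁.map C) (R.toBlocks₁₂.map C)
      (R.toBlocks₂₁.map C) (R.toBlocks₂₂.map C) := by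
    rw [← fromBlocks_map, fromBlocks_toBlocks]
  -- Left multiplication by R, of determinant 1, gives 1 + R diag(0, X), which is block upper
  -- triangular with lower right block 1 + R₂₂ X.
  rw [hg, ← one_mul (det _), ← hRC, ← det_mul, hsplit, mul_add, ← Matrix.map_mul, hR,
    Matrix.map_one _ (map_zero C) (map_one C), hRsplit, fromBlocks_multiply, ← fromBlocks_one,
    fromBlocks_add]
  simp only [Matrix.mul_zero, add_zero, zero_add]
  rw [det_fromBlocks_zero₂₁, det_one, one_mul, det_one_add_mul_comm]
  rfl

/-- Evaluation of `det (M + Z)` by interpolation from values of `det (1 + Y M)`. -/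
theorem det_add_diagonal_eq_sum (M : Matrix (Fin n) (Fin n) F) (z : Fin n → F) {s : ℕ → F}
    [DecidableEq F] (hs : Set.InjOn s (Finset.range (n + 1))) :
    (M + diagonal z).det = ∑ j ∈ Finset.range (n + 1),
      (∏ i, if z i = 0 then 1 else s j * z i) *
        MvPolynomial.eval (fun i => if z i = 0 then s j else 1 / z i) (reverseDet M) /
      ∏ l ∈ (Finset.range (n + 1)).erase j, (s j - s l) := by
  -- Row i of s(M + Z) + E is e_i + s M_i if z i = 0, and s z_i (e_i + M_i / z_i) otherwise. So its
  -- determinant at a node is an explicit multiple of det(1 + Y M) at a point without divisions by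
  -- zero, while its coefficient of sⁿ is det(M + Z).
  set E : Matrix (Fin n) (Fin n) F := diagonal fun i => if z i = 0 then 1 else 0 with hE
  set P := ((Polynomial.X : Polynomial F) • (M + diagonal z).map Polynomial.C +
    E.map Polynomial.C).det with hP
  have hdeg : P.degree < (Finset.range (n + 1)).card := by
    rw [Finset.card_range]
    refine Polynomial.degree_le_natDegree.trans_lt (Nat.cast_lt.2 (Nat.lt_succ_of_le ?_))
    simpa using Polynomial.natDegree_det_X_add_C_le (M + diagonal z) E
  have hcoeff := Lagrange.coeff_eq_sum hs hdeg
  have htop := Polynomial.coeff_det_X_add_C_card (M + diagonal z) E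
  rw [Fintype.card_fin] at htop
  rw [Finset.card_range, Nat.add_sub_cancel, htop] at hcoeff
  rw [hcoeff]
  refine Finset.sum_congr rfl fun j _ => ?_
  congr 1
  rw [← MvPolynomial.coe_aeval_eq_eval]
  refine Eq.trans ?_ (congrArg _ (aeval_reverseDet M _).symm)
  rw [← det_diagonal, ← det_mul, ← Polynomial.coe_evalRingHom, RingHom.map_det]
  congr 1
  ext i k
  by_cases hik : i = k
  · subst hik
    by_cases hz : z i = 0
    · simp [hE, hz, diagonal_mul]
      ring
    · simp [hE, hz, diagonal_mul]
      field_simp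
      ring
  · by_cases hz : z i = 0
    · simp [hE, hz, diagonal_mul, hik]
      exact mul_comm _ _
    · simp [hE, hz, diagonal_mul, hik]
      field_simp

end

/-! ### Evaluation of the transformed black box -/

namespace FieldRAM

/-- Entry `(i, 0, 0)` of array `a`. -/
abbrev vecEntry (a : ℕ) (i : NExp) : FExp := .cell a i (.const 0) (.const 0)

/-- Entry `(0, 0, 0)` of array `a`. -/
abbrev scalar (a : ℕ) : FExp := vecEntry a (.const 0)

/-- Assignment to entry `(i, 0, 0)` of array `a`. -/
abbrev setVec (a : ℕ) (i : NExp) (e : FExp) : Prog := .setCell a i (.const 0) (.const 0) e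

/-- Assignment to entry `(0, 0, 0)` of array `a`. -/
abbrev setScalar (a : ℕ) (e : FExp) : Prog := setVec a (.const 0) e

/-- Array `2` := the product of the coordinates of the vector in array `1`. -/
def productProg : Prog :=
  .seq (setScalar 2 .one)
    (.loop 3 (.reg 0) (setScalar 2 (.mul (scalar 2) (vecEntry 1 (.reg 3)))))

/-- Prepare the query point in array `5` and the factor in array `6`. -/
def pointProg : Prog :=
  .loop 3 (.reg 0)
    (.ite (.fieldEq (vecEntry 1 (.reg 3)) .zero)
      (setVec 5 (.reg 3) (.add (vecEntry 3 (.reg 3)) (vecEntry 0 (.reg 2))))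
      (.seq (setVec 5 (.reg 3) (.add (vecEntry 3 (.reg 3)) (.div .one (vecEntry 1 (.reg 3)))))
        (setScalar 6 (.mul (scalar 6) (.mul (vecEntry 0 (.reg 2)) (vecEntry 1 (.reg 3)))))))

/-- Divide array `6` by the differences of interpolation nodes. -/
def nodesProg : Prog :=
  .loop 4 (.add (.reg 0) (.const 1))
    (.ite (.natEq (.reg 4) (.reg 2)) .skip
      (setScalar 6 (.div (scalar 6) (.sub (vecEntry 0 (.reg 2)) (vecEntry 0 (.reg 4))))))

/-- One summand of the interpolation formula. -/
def summandProg : Prog :=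
  .seq (setScalar 6 .one) (.seq pointProg
    (.seq (.query 7 (.const 0) (.const 0) (.const 0) 5)
      (.seq (setScalar 6 (.div (.mul (scalar 6) (scalar 7)) (scalar 4)))
        (.seq nodesProg (setScalar 2 (.add (scalar 2) (scalar 6)))))))

/-- Evaluate `det (A + Z)` at the point in array `1`. -/
def evalProg : Prog :=
  .ite (.fieldEq (scalar 4) .zero) productProg
    (.seq (setScalar 2 .zero) (.loop 2 (.add (.reg 0) (.const 1)) summandProg))

/-! ### Correctness of the evaluation program -/

section

variable {F : Type*} [Field F] [DecidableEq F] {O : (ℕ → F) → F} {ω : ℕ → F}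

theorem wp_productProg {s : Store F} {d : ℕ} : wp O ω productProg (fun s' _ =>
    s'.cell 2 0 0 0 = ∏ i ∈ Finset.range (s.reg 0), s.cell 1 i 0 0) s d := by
  refine wp_seq (wp_setCell.2 (wp_loop (fun t s' _ =>
    s'.cell 2 0 0 0 = ∏ i ∈ Finset.range t, s.cell 1 i 0 0) ?_ ?_ ?_))
  · simp [Store.setCell, NExp.val, FExp.val]
  · intro i _ s' d' hA hI
    have h1 : s'.cell 1 = s.cell 1 := hA.cell 1 (by decide)
    rw [wp_setCell]
    simp [Store.setCell, Store.setReg, NExp.val, FExp.val, Finset.prod_range_succ, hI, h1]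
  · intro s' d' _ hI
    exact hI

theorem wp_pointProg {s : Store F} {d : ℕ} : wp O ω pointProg (fun s' _ =>
    (∀ i < s.reg 0, s'.cell 5 i 0 0 = s.cell 3 i 0 0 +
      if s.cell 1 i 0 0 = 0 then s.cell 0 (s.reg 2) 0 0 else 1 / s.cell 1 i 0 0) ∧
    s'.cell 6 0 0 0 = s.cell 6 0 0 0 * ∏ i ∈ Finset.range (s.reg 0),
      if s.cell 1 i 0 0 = 0 then 1 else s.cell 0 (s.reg 2) 0 0 * s.cell 1 i 0 0) s d := by
  refine wp_loop (fun t s' _ =>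
    (∀ i < t, s'.cell 5 i 0 0 = s.cell 3 i 0 0 +
      if s.cell 1 i 0 0 = 0 then s.cell 0 (s.reg 2) 0 0 else 1 / s.cell 1 i 0 0) ∧
    s'.cell 6 0 0 0 = s.cell 6 0 0 0 * ∏ i ∈ Finset.range t,
      if s.cell 1 i 0 0 = 0 then 1 else s.cell 0 (s.reg 2) 0 0 * s.cell 1 i 0 0) ?_ ?_ ?_
  · simp
  · rintro i - s' d' hA ⟨hI, hI'⟩
    have h0 : s'.cell 0 = s.cell 0 := hA.cell 0 (by decide)
    have h1 : s'.cell 1 = s.cell 1 := hA.cell 1 (by decide)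
    have h3 : s'.cell 3 = s.cell 3 := hA.cell 3 (by decide)
    have h2 : s'.reg 2 = s.reg 2 := hA.reg 2 (by decide)
    refine wp_ite (fun h => ?_) fun h => wp_seq ?_
    · simp only [Test.val, FExp.val, NExp.val, Store.setReg, h1, ↓reduceIte,
        decide_eq_true_eq] at h
      rw [wp_setCell]
      refine ⟨fun l hl => ?_, ?_⟩
      · rcases Nat.lt_succ_iff_lt_or_eq.1 hl with hl | rfl
        · simp [Store.setCell, Store.setReg, NExp.val, FExp.val, hl.ne, hI l hl]
        · simp [Store.setCell, Store.setReg, NExp.val, FExp.val, h0, h2, h3, h]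
      · simp [Store.setCell, Store.setReg, hI', Finset.prod_range_succ, h]
    · simp only [Test.val, FExp.val, NExp.val, Store.setReg, h1, ↓reduceIte,
        decide_eq_false_iff_not] at h
      rw [wp_setCell, wp_setCell]
      refine ⟨fun l hl => ?_, ?_⟩
      · rcases Nat.lt_succ_iff_lt_or_eq.1 hl with hl | rfl
        · simp [Store.setCell, Store.setReg, NExp.val, FExp.val, hl.ne, hI l hl]
        · simp [Store.setCell, Store.setReg, NExp.val, FExp.val, h1, h3, h]
      · simp [Store.setCell, Store.setReg, NExp.val, FExp.val, hI', Finset.prod_range_succ, h, h0,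
          h1, h2, mul_assoc]
  · intro s' d' _ hI
    exact hI

theorem wp_nodesProg {s : Store F} {d : ℕ} : wp O ω nodesProg (fun s' _ =>
    s'.cell 6 0 0 0 = s.cell 6 0 0 0 / ∏ l ∈ (Finset.range (s.reg 0 + 1)).erase (s.reg 2),
      (s.cell 0 (s.reg 2) 0 0 - s.cell 0 l 0 0)) s d := by
  refine wp_loop (fun t s' _ => s'.cell 6 0 0 0 = s.cell 6 0 0 0 /
    ∏ l ∈ Finset.range t, if l = s.reg 2 then 1 else
      (s.cell 0 (s.reg 2) 0 0 - s.cell 0 l 0 0)) ?_ ?_ ?_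
  · simp
  · rintro i - s' d' hA hI
    have h0 : s'.cell 0 = s.cell 0 := hA.cell 0 (by decide)
    have h2 : s'.reg 2 = s.reg 2 := hA.reg 2 (by decide)
    refine wp_ite (fun h => ?_) fun h => ?_
    · simp only [Test.val, NExp.val, Store.setReg, h2, ↓reduceIte, decide_eq_true_eq] at h
      rw [wp_skip]
      simp_all [Store.setReg, Finset.prod_range_succ]
    · simp only [Test.val, NExp.val, Store.setReg, h2, ↓reduceIte, decide_eq_false_iff_not] at h
      rw [wp_setCell]
      have h' : i ≠ s.reg 2 := by simpa using h
      simp [Store.setCell, Store.setReg, NExp.val, FExp.val, hI, Finset.prod_range_succ, h', h0,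
        h2, div_div]
  · intro s' d' _ hI
    rw [hI]
    congr 1
    rw [← Finset.prod_erase (a := s.reg 2) _ (by simp)]
    exact Finset.prod_congr rfl fun l hl => if_neg (Finset.ne_of_mem_erase hl)

theorem wp_summandProg {n : ℕ} {f : MvPolynomial (Fin n) F} {s : Store F} {d : ℕ}
    (hn : s.reg 0 = n) : wp (boxOf f) ω summandProg (fun s' _ =>
    s'.cell 2 0 0 0 = s.cell 2 0 0 0 + (∏ i ∈ Finset.range n,
      if s.cell 1 i 0 0 = 0 then 1 else s.cell 0 (s.reg 2) 0 0 * s.cell 1 i 0 0) *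
      MvPolynomial.eval (fun i : Fin n => s.cell 3 i 0 0 +
        if s.cell 1 i 0 0 = 0 then s.cell 0 (s.reg 2) 0 0 else 1 / s.cell 1 i 0 0) f /
      s.cell 4 0 0 0 / ∏ l ∈ (Finset.range (n + 1)).erase (s.reg 2),
        (s.cell 0 (s.reg 2) 0 0 - s.cell 0 l 0 0)) s d := by
  refine wp_seq (wp_setCell.2 (wp_seq (wp_pointProg.mono fun s₁ d₁ hA₁ h₁ => wp_seq
    (wp_query.2 (wp_seq (wp_setCell.2 (wp_seq (wp_nodesProg.mono fun s₂ d₂ hA₂ h₂ =>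
      wp_setCell.2 ?_))))))))
  obtain ⟨h₁, h₁'⟩ := h₁
  have e1 : s₁.cell 1 = s.cell 1 := hA₁.cell 1 (by decide)
  have e0 : s₁.cell 0 = s.cell 0 := hA₁.cell 0 (by decide)
  have e2 : s₁.cell 2 = s.cell 2 := hA₁.cell 2 (by decide)
  have e4 : s₁.cell 4 = s.cell 4 := hA₁.cell 4 (by decide)
  have r0 : s₁.reg 0 = n := (hA₁.reg 0 (by decide)).trans hn
  have r2 : s₁.reg 2 = s.reg 2 := hA₁.reg 2 (by decide)
  have e2' : s₂.cell 2 = s₁.cell 2 := hA₂.cell 2 (by decide)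
  simp only [Store.setCell, NExp.val, FExp.val] at h₁ h₁' h₂ ⊢
  simp [e0, e4, r0, r2, hn] at h₁ h₁' h₂ ⊢
  rw [e2', e2, h₂, h₁']
  have hp : boxOf f (fun l => s₁.cell 5 l 0 0) = MvPolynomial.eval (fun i : Fin n =>
      s.cell 3 i 0 0 + if s.cell 1 i 0 0 = 0 then s.cell 0 (s.reg 2) 0 0 else
        (s.cell 1 i 0 0)⁻¹) f := by
    unfold boxOf
    congr 2
    funext i
    exact h₁ i i.2
  rw [hp]

/-- Array 0 holds the nodes, array 1 the point z, array 3 the base point a, and array 4 the value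
f(a). The value 0 stands for f = 0, where the new matrix is 0 and the answer is det Z; otherwise
division by f(a) turns values of f near a into values of det(1 + Y M). -/
theorem wp_evalProg {n : ℕ} {f : MvPolynomial (Fin n) F} {s : Store F} {d : ℕ}
    (hn : s.reg 0 = n) : wp (boxOf f) ω evalProg (fun s' _ =>
    s'.cell 2 0 0 0 = if s.cell 4 0 0 0 = 0 then ∏ i ∈ Finset.range n, s.cell 1 i 0 0 else
      ∑ j ∈ Finset.range (n + 1), (∏ i ∈ Finset.range n,
        if s.cell 1 i 0 0 = 0 then 1 else s.cell 0 j 0 0 * s.cell 1 i 0 0) *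
        MvPolynomial.eval (fun i : Fin n => s.cell 3 i 0 0 +
          if s.cell 1 i 0 0 = 0 then s.cell 0 j 0 0 else 1 / s.cell 1 i 0 0) f /
        s.cell 4 0 0 0 / ∏ l ∈ (Finset.range (n + 1)).erase j,
          (s.cell 0 j 0 0 - s.cell 0 l 0 0)) s d := by
  refine wp_ite (fun h => ?_) fun h => wp_seq (wp_setCell.2 (wp_loop (fun t s' _ =>
    s'.cell 2 0 0 0 = ∑ j ∈ Finset.range t, (∏ i ∈ Finset.range n,
        if s.cell 1 i 0 0 = 0 then 1 else s.cell 0 j 0 0 * s.cell 1 i 0 0) *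
        MvPolynomial.eval (fun i : Fin n => s.cell 3 i 0 0 +
          if s.cell 1 i 0 0 = 0 then s.cell 0 j 0 0 else 1 / s.cell 1 i 0 0) f /
        s.cell 4 0 0 0 / ∏ l ∈ (Finset.range (n + 1)).erase j,
          (s.cell 0 j 0 0 - s.cell 0 l 0 0)) ?_ ?_ ?_))
  · replace h := of_decide_eq_true h
    simp only [FExp.val, NExp.val] at h
    refine wp_productProg.mono fun s' _ _ h' => ?_
    rw [h', hn, if_pos h]
  · simp [Store.setCell, NExp.val, FExp.val]
  · intro j _ s' d' hA hI
    have e0 : s'.cell 0 = s.cell 0 := hA.cell 0 (by decide)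
    have e1 : s'.cell 1 = s.cell 1 := hA.cell 1 (by decide)
    have e3 : s'.cell 3 = s.cell 3 := hA.cell 3 (by decide)
    have e4 : s'.cell 4 = s.cell 4 := hA.cell 4 (by decide)
    have r0 : s'.reg 0 = n := (hA.reg 0 (by decide)).trans hn
    refine (wp_summandProg (by simpa [Store.setReg] using r0)).mono fun s'' _ _ h'' => ?_
    rw [h'', Finset.sum_range_succ, ← hI]
    simp [Store.setReg, e0, e1, e3, e4]
  · replace h := of_decide_eq_false h
    simp only [FExp.val, NExp.val] at h
    intro s' d' _ hI
    rw [hI, if_neg h]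
    simp [NExp.val, Store.setCell, hn]

end

end FieldRAM

/-! ### Recovery of a representation with rank-one matrices -/

theorem det_one_add_vecMulVec {K : Type*} [CommRing K] {n : ℕ} (u v : Fin n → K) :
    (1 + vecMulVec u v).det = 1 + v ⬝ᵥ u := by
  rw [vecMulVec_eq Unit, det_one_add_replicateCol_mul_replicateRow]

/-- Rows of `A` that vanish may be given rank-one matrices that do not change the determinant. -/
theorem det_one_sub_add_sum_eq {K : Type*} [CommRing K] {n : ℕ} (A : Matrix (Fin n) (Fin n) K)
    (a y : Fin n → K) (Z : Fin n → Prop) [DecidablePred Z] (p : Fin n) (τ : Fin n → Fin n)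
    (hZ : ∀ i, Z i → A i = 0 ∧ A (τ i) = 0 ∧ τ i ≠ p) :
    (1 - diagonal a * A + ∑ l, y l • if Z l then vecMulVec (Pi.single p 1) (Pi.single (τ l) 1)
      else vecMulVec (Pi.single l 1) (A l)).det = (1 + diagonal (fun i => y i - a i) * A).det := by
  set w : Fin n → K := ∑ l, if Z l then Pi.single (τ l) (y l) else 0 with hw
  have hwA : w ᵥ* (diagonal (fun i => y i - a i) * A) = 0 := by
    rw [hw, sum_vecMul]
    refine Finset.sum_eq_zero fun l _ => ?_
    split_ifs with h
    · ext j
      simp [single_vecMul, diagonal_mul, (hZ l h).2.1]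
    · simp
  -- The replacement terms gather in e_p wᵀ. Since w lives on zero rows of A, wᵀ diag(y - a) A = 0,
  -- and the whole matrix factors; the left factor has determinant 1 + w_p = 1 because no τ l with Z
  -- l equals p.
  have hfac : 1 - diagonal a * A + ∑ l, y l • (if Z l then
      vecMulVec (Pi.single p 1) (Pi.single (τ l) 1) else vecMulVec (Pi.single l 1) (A l)) =
      (1 + vecMulVec (Pi.single p 1) w) * (1 + diagonal (fun i => y i - a i) * A) := by
    rw [add_mul, one_mul, mul_add, mul_one, vecMulVec_mul, hwA, vecMulVec_zero, add_zero]
    have hsum : ∑ l, y l • (if Z l then vecMulVec (Pi.single p 1) (Pi.single (τ l) 1) else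
        vecMulVec (Pi.single l 1) (A l)) = diagonal y * A + vecMulVec (Pi.single p 1) w := by
      have hdiag : diagonal y * A = ∑ l, y l • vecMulVec (Pi.single l 1) (A l) := by
        ext i j
        rw [Matrix.sum_apply, Finset.sum_eq_single i]
        · simp [diagonal_mul, vecMulVec_apply]
        · intro l _ hl
          simp [vecMulVec_apply, hl.symm]
        · simp
      have hwsum : vecMulVec (Pi.single p 1) w = ∑ l, if Z l then
          vecMulVec (Pi.single p (1 : K)) (Pi.single (τ l) (y l)) else 0 := by
        ext i j
        rw [vecMulVec_apply, hw, Matrix.sum_apply, Finset.sum_apply, Finset.mul_sum]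
        refine Finset.sum_congr rfl fun l _ => ?_
        split_ifs <;> simp [vecMulVec_apply]
      rw [hdiag, hwsum, ← Finset.sum_add_distrib]
      refine Finset.sum_congr rfl fun l _ => ?_
      split_ifs with h
      · rw [(hZ l h).1]
        ext i j
        by_cases hj : j = τ l <;> simp [vecMulVec_apply, hj, mul_comm]
      · rw [add_zero]
    have hsub : diagonal (fun i => y i - a i) = diagonal y - diagonal a := by
      rw [diagonal_sub]
    rw [hsum, hsub, sub_mul]
    abel
  have hwp : w p = 0 := by
    rw [hw, Finset.sum_apply]
    refine Finset.sum_eq_zero fun l _ => ?_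
    split_ifs with h
    · rw [Pi.single_eq_of_ne (hZ l h).2.2.symm]
    · rfl
  rw [hfac, det_mul, det_one_add_vecMulVec, dotProduct_single, hwp]
  simp

section

variable {F : Type*} [Field F] {n : ℕ}

/-- The right factor diag(D) multiplies the determinant by ∏ D and keeps outer products outer
products. It is used with D = (f(a), 1, …, 1). -/
theorem symbolicDet_recovery (A : Matrix (Fin n) (Fin n) F) (a D : Fin n → F)
    (Z : Fin n → Prop) [DecidablePred Z] (p : Fin n) (τ : Fin n → Fin n)
    (hZ : ∀ i, Z i → A i = 0 ∧ A (τ i) = 0 ∧ τ i ≠ p) :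
    symbolicDet ((1 - diagonal a * A) * diagonal D) (fun l => (if Z l then
      vecMulVec (Pi.single p 1) (Pi.single (τ l) 1) else vecMulVec (Pi.single l 1) (A l)) *
        diagonal D) =
    MvPolynomial.aeval (fun i => MvPolynomial.X i - MvPolynomial.C (a i)) (reverseDet A) *
      MvPolynomial.C (∏ i, D i) := by
  set C : F →+* MvPolynomial (Fin n) F := MvPolynomial.C
  have key := det_one_sub_add_sum_eq (A.map C) (fun i => C (a i)) MvPolynomial.X
    Z p τ fun i hi => by
      obtain ⟨h1, h2, h3⟩ := hZ i hi
      refine ⟨?_, ?_, h3⟩ <;> ext j : 1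
      · simp [h1]
      · simp [h2]
  rw [aeval_reverseDet]
  refine Eq.trans ?_ (congrArg (· * C (∏ i, D i)) key)
  have hD : C (∏ i, D i) = ((diagonal D).map C).det := by
    rw [diagonal_map (map_zero C), det_diagonal, map_prod]
  rw [hD, ← det_mul, add_mul, symbolicDet, Matrix.map_mul, Finset.sum_mul]
  congr 2
  · congr 1
    ext i j
    by_cases hij : i = j <;> simp [diagonal_mul, C, hij]
  · refine Finset.sum_congr rfl fun l _ => ?_
    rw [Matrix.map_mul, ← Matrix.smul_mul]
    congr 2
    split_ifs
    · ext i j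
      by_cases hi : i = p <;> by_cases hj : j = τ l <;> simp [vecMulVec_apply, hi, hj]
    · ext i j
      by_cases hi : i = l <;> simp [vecMulVec_apply, C, hi]

end

namespace FieldRAM

/-- Clear the matrix in array `1` if the preprocessing found no nonzero value. -/
def clearProg : Prog :=
  .ite (.fieldEq (scalar 4) .zero)
    (.loop 2 (.reg 0) (.loop 3 (.reg 0) (.setCell 1 (.reg 2) (.reg 3) (.const 0) .zero))) .skip

/-- Flag the nonzero rows of the matrix in array `1`, and remember the last of them. -/
def flagProg : Prog :=
  .seq (.setReg 5 (.const 0))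
    (.loop 2 (.reg 0) (.seq (setVec 8 (.reg 2) .zero)
      (.loop 3 (.reg 0) (.ite (.fieldEq (.cell 1 (.reg 2) (.reg 3) (.const 0)) .zero) .skip
        (.seq (setVec 8 (.reg 2) .one) (.setReg 5 (.reg 2)))))))

/-- Array `9` := `1` if register `3` is `a` and register `4` is `b`, and `0` otherwise. -/
def indicatorProg (a b : NExp) : Prog :=
  .ite (.natEq (.reg 3) a)
    (.ite (.natEq (.reg 4) b) (setScalar 9 .one) (setScalar 9 .zero)) (setScalar 9 .zero)

/-- Array `9` := an entry of a recovered matrix, before scaling. -/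
def entryProg : Prog :=
  .ite (.natEq (.reg 2) (.const 0))
    (.ite (.natEq (.reg 3) (.reg 4))
      (setScalar 9 (.sub .one
        (.mul (vecEntry 3 (.reg 3)) (.cell 1 (.reg 3) (.reg 4) (.const 0)))))
      (setScalar 9 (.sub .zero
        (.mul (vecEntry 3 (.reg 3)) (.cell 1 (.reg 3) (.reg 4) (.const 0))))))
    (.ite (.fieldEq (vecEntry 8 (.sub (.reg 2) (.const 1))) .zero)
      (.ite (.natEq (.sub (.reg 2) (.const 1)) (.reg 5))
        (indicatorProg (.reg 5) (.const 1))
        (indicatorProg (.reg 5) (.sub (.reg 2) (.const 1))))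
      (.ite (.natEq (.reg 3) (.sub (.reg 2) (.const 1)))
        (setScalar 9 (.cell 1 (.sub (.reg 2) (.const 1)) (.reg 4) (.const 0)))
        (setScalar 9 .zero)))

/-- Write an entry of the output, with the first column scaled. -/
def storeProg : Prog :=
  .ite (.natEq (.reg 4) (.const 0))
    (.setCell 2 (.reg 2) (.reg 3) (.reg 4) (.mul (scalar 9) (scalar 4)))
    (.setCell 2 (.reg 2) (.reg 3) (.reg 4) (scalar 9))

def columnsProg : Prog := .loop 4 (.reg 0) (.seq entryProg storeProg)

def rowsProg : Prog := .loop 3 (.reg 0) columnsProg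

def slicesProg : Prog := .loop 2 (.add (.reg 0) (.const 1)) rowsProg

/-- Recover a representation of the black box from the matrix in array `1`. -/
def recoverProg : Prog := .seq clearProg (.seq flagProg slicesProg)

/-- The entries that `entryProg` computes. -/
def recoveredEntry {F : Type*} [Field F] [DecidableEq F] (s : Store F) (l i j : ℕ) : F :=
  if l = 0 then (if i = j then 1 else 0) - s.cell 3 i 0 0 * s.cell 1 i j 0
  else if s.cell 8 (l - 1) 0 0 = 0 then
    (if i = s.reg 5 ∧ j = (if l - 1 = s.reg 5 then 1 else l - 1) then 1 else 0)
  else if i = l - 1 then s.cell 1 (l - 1) j 0 else 0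

/-! ### Correctness of the parts of the recovery program -/

section

variable {F : Type*} [Field F] [DecidableEq F] {O : (ℕ → F) → F} {ω : ℕ → F}

theorem wp_clearProg {s : Store F} {d : ℕ} : wp O ω clearProg (fun s' _ =>
    ∀ i < s.reg 0, ∀ j < s.reg 0,
      s'.cell 1 i j 0 = if s.cell 4 0 0 0 = 0 then 0 else s.cell 1 i j 0) s d := by
  refine wp_ite (fun h => ?_) fun h => wp_skip.2 ?_
  · replace h := of_decide_eq_true h
    simp only [FExp.val, NExp.val] at h
    simp only [h, if_true]
    refine wp_loop (fun t s' _ => ∀ i < t, ∀ j < s.reg 0, s'.cell 1 i j 0 = 0) (by simp) ?_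
      fun s' _ _ h => h
    intro i hi s' d' hA hI
    have r0 : s'.reg 0 = s.reg 0 := hA.reg 0 (by decide)
    refine wp_loop (fun t s' _ => (∀ i' < i, ∀ j < s.reg 0, s'.cell 1 i' j 0 = 0) ∧
      ∀ j < t, s'.cell 1 i j 0 = 0) ⟨hI, by simp⟩ ?_ ?_
    · rintro j - s'' d'' hA' ⟨h1, h2⟩
      have r2 : s''.reg 2 = i := hA'.reg 2 (by decide)
      rw [wp_setCell]
      simp only [Store.setCell, Store.setReg, NExp.val, FExp.val]
      grind
    · rintro s'' d'' hA' ⟨h1, h2⟩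
      simp only [Store.setReg, NExp.val] at h2
      grind
  · replace h := of_decide_eq_false h
    simp only [FExp.val, NExp.val] at h
    simp [h]

/-- Register 5 supplies the row p of the replacement matrices: a nonzero row if there is one, and 0
if the matrix vanishes. -/
theorem wp_flagProg {s : Store F} {d : ℕ} : wp O ω flagProg (fun s' _ =>
    (∀ i < s.reg 0, s'.cell 8 i 0 0 = 0 ↔ ∀ j < s.reg 0, s.cell 1 i j 0 = 0) ∧
    ((s'.reg 5 < s.reg 0 ∧ ∃ j < s.reg 0, s.cell 1 (s'.reg 5) j 0 ≠ 0) ∨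
      s'.reg 5 = 0 ∧ ∀ i < s.reg 0, ∀ j < s.reg 0, s.cell 1 i j 0 = 0)) s d := by
  refine wp_seq (wp_setReg.2 (wp_loop (fun t s' _ =>
    (∀ i < t, s'.cell 8 i 0 0 = 0 ↔ ∀ j < s.reg 0, s.cell 1 i j 0 = 0) ∧
    ((s'.reg 5 < t ∧ ∃ j < s.reg 0, s.cell 1 (s'.reg 5) j 0 ≠ 0) ∨
      s'.reg 5 = 0 ∧ ∀ i < t, ∀ j < s.reg 0, s.cell 1 i j 0 = 0)) ?_ ?_ fun _ _ _ h => h))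
  · simp [Store.setReg, NExp.val]
  · rintro i hi s' d' hA ⟨h1, h2⟩
    have r0 : s'.reg 0 = s.reg 0 := hA.reg 0 (by decide)
    have e1 : s'.cell 1 = s.cell 1 := hA.cell 1 (by decide)
    -- Within row i there are three states: an earlier nonzero row is remembered and row i is zero
    -- so far; row i has been found nonzero; nothing nonzero has been seen.
    refine wp_seq (wp_setCell.2 (wp_loop (fun t s' _ =>
      (∀ i' < i, s'.cell 8 i' 0 0 = 0 ↔ ∀ j < s.reg 0, s.cell 1 i' j 0 = 0) ∧
      (s'.cell 8 i 0 0 = 0 ↔ ∀ j < t, s.cell 1 i j 0 = 0) ∧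
      ((s'.reg 5 < i ∧ ∃ j < s.reg 0, s.cell 1 (s'.reg 5) j 0 ≠ 0) ∧
          (∀ j < t, s.cell 1 i j 0 = 0) ∨
        (s'.reg 5 = i ∧ ∃ j < t, s.cell 1 i j 0 ≠ 0) ∨
        s'.reg 5 = 0 ∧ (∀ i' < i, ∀ j < s.reg 0, s.cell 1 i' j 0 = 0) ∧
          ∀ j < t, s.cell 1 i j 0 = 0)) ?_ ?_ ?_))
    · simp only [Store.setCell, Store.setReg, NExp.val, FExp.val]
      grind
    · rintro j hj s'' d'' hA' ⟨h3, h4, h5⟩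
      have r2 : s''.reg 2 = i := hA'.reg 2 (by decide)
      have e1' : s''.cell 1 = s.cell 1 := (hA'.cell 1 (by decide)).trans e1
      replace hj : j < s.reg 0 := by simpa [NExp.val, Store.setReg, Store.setCell, r0] using hj
      refine wp_ite (fun h => wp_skip.2 ?_) fun h => wp_seq (wp_setCell.2 (wp_setReg.2 ?_))
      · replace h := of_decide_eq_true h
        simp only [FExp.val, NExp.val, Store.setReg, e1'] at h
        simp only [Store.setReg]
        grind
      · replace h := of_decide_eq_false h
        simp only [FExp.val, NExp.val, Store.setReg, e1'] at h
        simp only [Store.setReg, Store.setCell, NExp.val, FExp.val]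
        grind
    · rintro s'' d'' - ⟨h3, h4, h5⟩
      simp only [Store.setReg, Store.setCell, NExp.val, r0] at h4 h5
      grind

theorem wp_entryProg {s : Store F} {d : ℕ} : wp O ω entryProg (fun s' _ =>
    s'.cell 9 0 0 0 = recoveredEntry s (s.reg 2) (s.reg 3) (s.reg 4)) s d := by
  unfold entryProg indicatorProg
  repeat' (first | refine wp_setCell.2 ?_ | refine wp_ite (fun h => ?_) fun h => ?_)
  all_goals
    simp only [Test.val, FExp.val, NExp.val] at *
    simp only [recoveredEntry, Store.setCell]
    grind

theorem wp_columnsProg {s : Store F} {d : ℕ} : wp O ω columnsProg (fun s' _ =>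
    s'.cell 2 = fun l i j => if l = s.reg 2 ∧ i = s.reg 3 ∧ j < s.reg 0 then
      recoveredEntry s l i j * (if j = 0 then s.cell 4 0 0 0 else 1) else s.cell 2 l i j) s d := by
  refine wp_loop (fun t s' _ => s'.cell 2 = fun l i j =>
    if l = s.reg 2 ∧ i = s.reg 3 ∧ j < t then
      recoveredEntry s l i j * (if j = 0 then s.cell 4 0 0 0 else 1) else s.cell 2 l i j)
    (by simp) ?_ fun _ _ _ h => h
  intro j _ s' d' hA hI
  have r2 : s'.reg 2 = s.reg 2 := hA.reg 2 (by decide)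
  have r3 : s'.reg 3 = s.reg 3 := hA.reg 3 (by decide)
  have r5 : s'.reg 5 = s.reg 5 := hA.reg 5 (by decide)
  have e1 : s'.cell 1 = s.cell 1 := hA.cell 1 (by decide)
  have e3 : s'.cell 3 = s.cell 3 := hA.cell 3 (by decide)
  have e4 : s'.cell 4 = s.cell 4 := hA.cell 4 (by decide)
  have e8 : s'.cell 8 = s.cell 8 := hA.cell 8 (by decide)
  refine wp_seq (wp_entryProg.mono fun s₁ d₁ hA₁ h₁ => ?_)
  have h₁' : s₁.cell 9 0 0 0 = recoveredEntry s (s.reg 2) (s.reg 3) j := by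
    rw [h₁]
    simp [recoveredEntry, Store.setReg, r2, r3, r5, e1, e3, e8]
  have q2 : s₁.reg 2 = s.reg 2 := (hA₁.reg 2 (by decide)).trans r2
  have q3 : s₁.reg 3 = s.reg 3 := (hA₁.reg 3 (by decide)).trans r3
  have q4 : s₁.reg 4 = j := hA₁.reg 4 (by decide)
  have f4 : s₁.cell 4 = s.cell 4 := (hA₁.cell 4 (by decide)).trans e4
  have f2 : s₁.cell 2 = s'.cell 2 := hA₁.cell 2 (by decide)
  refine wp_ite (fun h => wp_setCell.2 ?_) fun h => wp_setCell.2 ?_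
  · replace h := of_decide_eq_true h
    simp only [NExp.val, q4] at h
    funext l' i' j'
    simp only [Store.setCell, NExp.val, FExp.val, h₁', q2, q3, q4, f4, f2, hI]
    grind
  · replace h := of_decide_eq_false h
    simp only [NExp.val, q4] at h
    funext l' i' j'
    simp only [Store.setCell, NExp.val, FExp.val, h₁', q2, q3, q4, f2, hI]
    grind

theorem wp_rowsProg {s : Store F} {d : ℕ} : wp O ω rowsProg (fun s' _ =>
    s'.cell 2 = fun l i j => if l = s.reg 2 ∧ i < s.reg 0 ∧ j < s.reg 0 then
      recoveredEntry s l i j * (if j = 0 then s.cell 4 0 0 0 else 1) else s.cell 2 l i j) s d := by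
  refine wp_loop (fun t s' _ => s'.cell 2 = fun l i j =>
    if l = s.reg 2 ∧ i < t ∧ j < s.reg 0 then
      recoveredEntry s l i j * (if j = 0 then s.cell 4 0 0 0 else 1) else s.cell 2 l i j)
    (by simp) ?_ fun _ _ _ h => h
  intro i _ s' d' hA hI
  refine wp_columnsProg.mono fun s₁ d₁ hA₁ h₁ => ?_
  rw [h₁]
  funext l' i' j'
  simp only [recoveredEntry, Store.setReg, hA.reg 2 (by decide), hA.reg 0 (by decide),
    hA.reg 5 (by decide), hA.cell 1 (by decide), hA.cell 3 (by decide), hA.cell 4 (by decide),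
    hA.cell 8 (by decide), hI]
  grind

theorem wp_slicesProg {s : Store F} {d : ℕ} : wp O ω slicesProg (fun s' _ =>
    s'.cell 2 = fun l i j => if l < s.reg 0 + 1 ∧ i < s.reg 0 ∧ j < s.reg 0 then
      recoveredEntry s l i j * (if j = 0 then s.cell 4 0 0 0 else 1) else s.cell 2 l i j) s d := by
  refine wp_loop (fun t s' _ => s'.cell 2 = fun l i j =>
    if l < t ∧ i < s.reg 0 ∧ j < s.reg 0 then
      recoveredEntry s l i j * (if j = 0 then s.cell 4 0 0 0 else 1) else s.cell 2 l i j)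
    (by simp) ?_ fun _ _ _ h => h
  intro i _ s' d' hA hI
  refine wp_rowsProg.mono fun s₁ d₁ hA₁ h₁ => ?_
  rw [h₁]
  funext l' i' j'
  simp only [recoveredEntry, Store.setReg, hA.reg 0 (by decide),
    hA.reg 5 (by decide), hA.cell 1 (by decide), hA.cell 3 (by decide), hA.cell 4 (by decide),
    hA.cell 8 (by decide), hI]
  grind

end

end FieldRAM

/-! ### Correctness of evaluation and recovery -/

/-- If p is a nonzero row, a zero row i differs from p and is its own target. If A = 0, then p = 0
and row 0 needs another target; row 1 serves, and it exists because the hypothesis excludes n = 1.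
-/
theorem exists_row_target {F : Type*} [Field F] {n : ℕ} (A : Matrix (Fin n) (Fin n) F)
    (hn : n = 1 → ∀ i, A i ≠ 0) {p : ℕ} (h : (∃ h : p < n, A ⟨p, h⟩ ≠ 0) ∨ p = 0 ∧ A = 0)
    (i : Fin n) (hi : A i = 0) :
    ∃ q : Fin n, (q : ℕ) = (if (i : ℕ) = p then 1 else (i : ℕ)) ∧ A q = 0 ∧ (q : ℕ) ≠ p := by
  rcases h with ⟨hp, hA⟩ | ⟨rfl, hA⟩
  · have hip : (i : ℕ) ≠ p := by
      rintro rfl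
      exact hA hi
    exact ⟨i, by simp [hip], hi, hip⟩
  · by_cases hi0 : (i : ℕ) = 0
    · have h1 : 1 < n := by
        have := i.2
        rcases Nat.lt_or_ge 1 n with h | h
        · exact h
        · exact absurd hi (hn (by omega) i)
      exact ⟨⟨1, h1⟩, by simp [hi0], by rw [hA]; rfl, by simp⟩
    · exact ⟨i, by simp [hi0], hi, hi0⟩

namespace FieldRAM

section

variable {F : Type*} [Field F] [DecidableEq F] {O : (ℕ → F) → F} {ω : ℕ → F}

/-- The scale δ sits in column 0. If δ = 0, the matrix was cleared, so p = 0 and every replacement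
e_p e_τᵀ has τ ≠ 0: scaling column 0 by zero kills the determinant but none of the rank-one
matrices. -/
theorem recoverProg_correct {n : ℕ} (hn : 1 ≤ n) {s : Store F} (hs : s.reg 0 = n)
    (hone : n = 1 → s.cell 4 0 0 0 ≠ 0 ∧ ∀ i : Fin n, s.readMat 1 n i ≠ 0) {d : ℕ} :
    wp O ω recoverProg (fun t _ => (∀ i : Fin n, (t.readSlice 2 (i + 1) n).rank = 1) ∧
      symbolicDet (t.readSlice 2 0 n) (fun i : Fin n => t.readSlice 2 (i + 1) n) =
        if s.cell 4 0 0 0 = 0 then 0 else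
          MvPolynomial.C (s.cell 4 0 0 0) * MvPolynomial.aeval (fun i : Fin n => MvPolynomial.X i -
            MvPolynomial.C (s.cell 3 i 0 0)) (reverseDet (s.readMat 1 n))) s d := by
  refine wp_seq (wp_clearProg.mono fun s₁ d₁ hA₁ h₁ => wp_seq (wp_flagProg.mono
    fun s₂ d₂ hA₂ h₂ => wp_slicesProg.mono fun s₃ d₃ _ h₃ => ?_))
  have e3 : s₂.cell 3 = s.cell 3 := (hA₂.cell 3 (by decide)).trans (hA₁.cell 3 (by decide))
  have e4 : s₂.cell 4 = s.cell 4 := (hA₂.cell 4 (by decide)).trans (hA₁.cell 4 (by decide))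
  have e1 : s₂.cell 1 = s₁.cell 1 := hA₂.cell 1 (by decide)
  have r0 : s₁.reg 0 = n := (hA₁.reg 0 (by decide)).trans hs
  have r0' : s₂.reg 0 = n := (hA₂.reg 0 (by decide)).trans r0
  rw [hs] at h₁
  rw [r0] at h₂
  rw [r0', e4] at h₃
  obtain ⟨hflag, hp⟩ := h₂
  set δ := s.cell 4 0 0 0 with hδ
  set A : Matrix (Fin n) (Fin n) F := s₁.readMat 1 n with hA
  set a : Fin n → F := fun i => s.cell 3 i 0 0 with ha
  set D : Fin n → F := fun j => if (j : ℕ) = 0 then δ else 1 with hD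
  have hrow : ∀ i : Fin n, A i = 0 ↔ ∀ j < n, s₁.cell 1 i j 0 = 0 := fun i =>
    ⟨fun h j hj => congrFun h ⟨j, hj⟩, fun h => funext fun j => h j j.2⟩
  have hAδ : δ ≠ 0 → A = s.readMat 1 n := fun h => by
    ext i j
    exact (h₁ i i.2 j j.2).trans (if_neg h)
  have hA0 : δ = 0 → A = 0 := fun h => by
    ext i j
    exact (h₁ i i.2 j j.2).trans (if_pos h)
  have hp' : (∃ h : s₂.reg 5 < n, A ⟨s₂.reg 5, h⟩ ≠ 0) ∨ s₂.reg 5 = 0 ∧ A = 0 := by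
    rcases hp with ⟨h1, j, hj, h2⟩ | ⟨h1, h2⟩
    · exact Or.inl ⟨h1, fun h => h2 (congrFun h ⟨j, hj⟩)⟩
    · exact Or.inr ⟨h1, by ext i j; exact h2 i i.2 j j.2⟩
  have hpn : s₂.reg 5 < n := by
    rcases hp' with ⟨h, -⟩ | ⟨h, -⟩ <;> omega
  have htarget := exists_row_target A (fun h i => by
    rw [hAδ (hone h).1]
    exact (hone h).2 i) hp'
  choose! τ hτ1 hτ2 hτ3 using htarget
  set p : Fin n := ⟨s₂.reg 5, hpn⟩ with hpdef
  let Z : Fin n → Prop := fun i => s₂.cell 8 i 0 0 = 0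
  have hZrow : ∀ i : Fin n, Z i ↔ A i = 0 := fun i => (hflag i i.2).trans (hrow i).symm
  have hZ : ∀ i, Z i → A i = 0 ∧ A (τ i) = 0 ∧ τ i ≠ p := fun i hi => by
    have hi' := (hZrow i).1 hi
    exact ⟨hi', hτ2 i hi', fun h => hτ3 i hi' (congrArg Fin.val h)⟩
  let _ : DecidablePred Z := fun i => decEq (s₂.cell 8 i 0 0) 0
  have hB0 : s₃.readSlice 2 0 n = (1 - diagonal a * A) * diagonal D := by
    ext i j
    have hij : ((i : ℕ) = j) = (i = j) := by rw [Fin.ext_iff]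
    simp only [Store.readSlice, h₃, recoveredEntry, e3, e1, hij]
    simp [mul_diagonal, diagonal_mul, one_apply, hD, ha, hA, Store.readMat]
  have hB : ∀ l : Fin n, s₃.readSlice 2 (l + 1) n = (if Z l then vecMulVec (Pi.single p 1)
      (Pi.single (τ l) 1) else vecMulVec (Pi.single l 1) (A l)) * diagonal D := fun l => by
    ext i j
    simp only [Store.readSlice, h₃, recoveredEntry, e1, Nat.add_sub_cancel, mul_diagonal]
    have hl : (l : ℕ) + 1 ≠ 0 := by omega
    have hcond : (l : ℕ) + 1 < n + 1 ∧ (i : ℕ) < n ∧ (j : ℕ) < n := ⟨by omega, i.2, j.2⟩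
    rw [if_pos hcond, if_neg hl]
    congr 1
    by_cases h : Z l
    · rw [if_pos h, if_pos h, ← hτ1 l ((hZrow l).1 h), vecMulVec_apply]
      have hi : ((i : ℕ) = s₂.reg 5) = (i = p) := by rw [Fin.ext_iff]
      have hj : ((j : ℕ) = τ l) = (j = τ l) := by rw [Fin.ext_iff]
      simp only [hi, hj]
      by_cases h1 : i = p <;> by_cases h2 : j = τ l <;> simp [h1, h2]
    · rw [if_neg h, if_neg h, vecMulVec_apply]
      by_cases h1 : i = l
      · simp [h1, hA, Store.readMat]
      · have h1' : (i : ℕ) ≠ l := fun h => h1 (Fin.ext h)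
        simp [h1, h1']
  have hDne : ∀ j : Fin n, (δ = 0 → (j : ℕ) ≠ 0) → D j ≠ 0 := fun j hj => by
    simp only [hD]
    split_ifs with h
    · exact fun h' => hj h' h
    · exact one_ne_zero
  refine ⟨fun l => ?_, ?_⟩
  · rw [hB]
    by_cases h : Z l
    · rw [if_pos h, vecMulVec_mul]
      refine rank_vecMulVec_eq_one (by simp) (Function.ne_iff.2 ⟨τ l, ?_⟩)
      -- Only D 0 can vanish, namely when δ = 0; then p = 0, and τ l ≠ p keeps the target away from
      -- column 0.
      have hne : D (τ l) ≠ 0 := hDne _ fun h0 => by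
        have h5 : s₂.reg 5 = 0 := by
          rcases hp' with ⟨h6, h7⟩ | ⟨h6, -⟩
          · rw [hA0 h0] at h7
            exact absurd rfl h7
          · exact h6
        have := hτ3 l ((hZrow l).1 h)
        rwa [h5] at this
      simpa [single_vecMul] using hne
    · rw [if_neg h, vecMulVec_mul]
      have hAl : A l ≠ 0 := fun h' => h ((hZrow l).2 h')
      have hδ0 : δ ≠ 0 := fun h' => hAl (by rw [hA0 h']; rfl)
      obtain ⟨j, hj⟩ := Function.ne_iff.1 hAl
      refine rank_vecMulVec_eq_one (by simp) (Function.ne_iff.2 ⟨j, ?_⟩)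
      rw [vecMul_diagonal]
      exact mul_ne_zero hj (hDne j fun h => absurd h hδ0)
  · have hprod : ∏ i, D i = δ := by
      rw [Finset.prod_eq_single ⟨0, hn⟩]
      · simp [hD]
      · intro j _ hj
        have : (j : ℕ) ≠ 0 := fun h => hj (Fin.ext h)
        simp [hD, this]
      · simp
    rw [hB0, funext hB, symbolicDet_recovery A a D Z p τ hZ, hprod]
    split_ifs with h
    · rw [h, map_zero, mul_zero]
    · rw [hAδ h, mul_comm]

/-- What preprocessing has to establish. -/
structure Prepared {n : ℕ} (f : MvPolynomial (Fin n) F) (S : Fin (n + 2) ↪ F) (s : Store F) :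
    Prop where
  size : s.reg 0 = n
  nodes : s.cell 0 = vecArray S
  value : s.cell 4 0 0 0 = MvPolynomial.eval (fun i : Fin n => s.cell 3 i 0 0) f
  found : s.cell 4 0 0 0 = 0 → f = 0

/-- For f = 0 the matrix 0 is chosen, and non-constancy rules out n = 1. Otherwise the matrix is the
M of the expansion of f around the point found. -/
theorem Prepared.goodPreprocessing {n r : ℕ} (hn : 1 ≤ n) {S : Fin (n + 2) ↪ F}
    {A₀ : Matrix (Fin r) (Fin r) F} {A : Fin n → Matrix (Fin r) (Fin r) F}
    (hA : ∀ i, (A i).rank = 1)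
    (hone : n = 1 → ∀ a : F, symbolicDet A₀ A ≠ MvPolynomial.C a) {s : Store F}
    (hs : Prepared (symbolicDet A₀ A) S s) :
    GoodPreprocessing evalProg recoverProg (symbolicDet A₀ A) s := by
  set f := symbolicDet A₀ A with hf
  by_cases hδ : s.cell 4 0 0 0 = 0
  · have hf0 := hs.found hδ
    refine ⟨0, fun z => ?_, fun A' _ => ?_⟩
    · have h := (wp_evalProg (f := f) (s := s.load 1 (vecArray z)) (ω := fun _ => 0) (d := 0)
        hs.size).run
      refine h.trans ?_
      rw [if_pos (by simpa [Store.load] using hδ), eval_diagonalDet, zero_add, det_diagonal,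
        Finset.prod_range]
      simp [Store.load, vecArray]
    · have h := (recoverProg_correct (O := noBox) (ω := fun _ => 0) hn
        (s := s.load 1 (matArray A')) hs.size (fun h => absurd (hf0.trans (map_zero _).symm)
          (hone h 0)) (d := 0)).run
      refine ⟨h.1, ?_⟩
      rw [if_pos (by simpa [Store.load] using hδ)] at h
      exact hf0.trans h.2.symm
  · have hδ' := hδ
    rw [hs.value] at hδ'
    obtain ⟨M, hM⟩ := exists_aeval_symbolicDet_eq hA hδ'
    refine ⟨M, fun z => ?_, fun A' hA' => ?_⟩
    · have h := (wp_evalProg (f := f) (s := s.load 1 (vecArray z)) (ω := fun _ => 0) (d := 0)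
        hs.size).run
      refine h.trans ?_
      have hinj : Set.InjOn (fun j => s.cell 0 j 0 0) (Finset.range (n + 1)) := by
        intro i hi j hj hij
        have hi' : i < n + 2 := by
          have := Finset.mem_range.1 hi
          omega
        have hj' : j < n + 2 := by
          have := Finset.mem_range.1 hj
          omega
        simp only [hs.nodes, vecArray, hi', hj', dite_true, and_self, if_true] at hij
        exact congrArg Fin.val (S.injective hij)
      rw [if_neg (by simpa [Store.load] using hδ), eval_diagonalDet,
        det_add_diagonal_eq_sum M z hinj]
      refine Finset.sum_congr rfl fun j _ => ?_
      have h1 : ∀ i : Fin n, (s.load 1 (vecArray z)).cell 1 i 0 0 = z i := fun i => by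
        simp [Store.load, vecArray]
      have h0 : (s.load 1 (vecArray z)).cell 0 = s.cell 0 := rfl
      have h3 : (s.load 1 (vecArray z)).cell 3 = s.cell 3 := rfl
      have h4 : (s.load 1 (vecArray z)).cell 4 = s.cell 4 := rfl
      rw [Finset.prod_range]
      simp only [h1, h0, h3, h4]
      congr 1
      rw [mul_div_assoc]
      congr 1
      rw [div_eq_iff hδ, hs.value]
      -- The expansion with numerical increments: the program's query points are a + y with exactly
      -- these y.
      have key := hM (K := F) fun i => if z i = 0 then s.cell 0 j 0 0 else 1 / z i
      rw [mul_comm, ← MvPolynomial.coe_aeval_eq_eval]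
      exact key
    · have hrev : reverseDet A' = reverseDet M := diagonalDet_eq_iff_reverseDet_eq.1 hA'
      have hread : (s.load 1 (matArray A')).readMat 1 n = A' := by
        ext i j
        simp [Store.readMat, Store.load, matArray]
      -- The expansion over the polynomial ring, with increments X_i - a_i, is an identity for f
      -- itself.
      have key := hM (K := MvPolynomial (Fin n) F) fun i =>
        MvPolynomial.X i - MvPolynomial.C (s.cell 3 i 0 0)
      simp only [MvPolynomial.algebraMap_eq, add_sub_cancel] at key
      have hX : MvPolynomial.aeval (fun i : Fin n => (MvPolynomial.X i : MvPolynomial (Fin n) F)) f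
          = f := MvPolynomial.aeval_X_left_apply f
      rw [hX, ← hs.value, ← hrev] at key
      have h := (recoverProg_correct (O := noBox) (ω := fun _ => 0) hn
        (s := s.load 1 (matArray A')) hs.size (fun h1 => ⟨hδ, fun i hi => by
          rw [hread] at hi
          have hzero : A' = 0 := by
            ext i' j
            have : i' = i := Fin.ext (by omega)
            rw [this, hi]
            rfl
          -- For n = 1 a vanishing A' would make f equal to the constant f(a).
          refine hone h1 (s.cell 4 0 0 0) ?_
          rw [key, hzero, aeval_reverseDet]
          simp⟩) (d := 0)).run
      rw [hread, if_neg (by simpa [Store.load] using hδ)] at h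
      exact ⟨h.1, key.trans h.2.symm⟩

end

end FieldRAM

/-! ### Randomized preprocessing -/

namespace FieldRAM

/-- Draw a new point unless the black box is nonzero at the present one. -/
def trialProg : Prog :=
  .ite (.fieldEq (scalar 4) .zero)
    (.seq (.loop 4 (.reg 0) (.draw 3 (.reg 4) (.const 0) (.const 0)))
      (.query 4 (.const 0) (.const 0) (.const 0) 3)) .skip

/-- A batch of n + 2 trials is long enough to halve the probability of failure. -/
def trialsProg : Prog := .loop 3 (.add (.reg 0) (.const 2)) trialProg

/-- Look for a point at which the black box is nonzero. -/
def prepProg : Prog :=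
  -- On blank memory the first query is at the origin; it makes the stored value correct even when
  -- no trial follows.
  .seq (.query 4 (.const 0) (.const 0) (.const 0) 3) (.loop 2 (.reg 1) trialsProg)

section

variable {F : Type*} [Field F] {ω : ℕ → F}

/-- The invariant of the search for a nonzero value, after `t` trials. -/
structure Searched {n : ℕ} (f : MvPolynomial (Fin n) F) (ω : ℕ → F) (t : ℕ) (s : Store F)
    (d : ℕ) : Prop where
  value : s.cell 4 0 0 0 = MvPolynomial.eval (fun i : Fin n => s.cell 3 i 0 0) f
  -- As long as all values were zero, each trial has consumed exactly n draws, so trial t' reads the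
  -- t'-th block of the tape. After a success the count no longer matters.
  draws : s.cell 4 0 0 0 = 0 → d = t * n
  zeros : s.cell 4 0 0 0 = 0 → ∀ t' < t, MvPolynomial.eval (fun i : Fin n => ω (t' * n + i)) f = 0

theorem Searched.congr {n t : ℕ} {f : MvPolynomial (Fin n) F} {s s' : Store F} {d : ℕ}
    (h : Searched f ω t s d) (hs : s'.cell = s.cell) : Searched f ω t s' d :=
  ⟨by rw [hs]; exact h.value, by rw [hs]; exact h.draws, by rw [hs]; exact h.zeros⟩

variable [DecidableEq F]

theorem wp_trialProg {n t : ℕ} {f : MvPolynomial (Fin n) F} {s : Store F} {d : ℕ}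
    (hn : s.reg 0 = n) (h : Searched f ω t s d) :
    wp (boxOf f) ω trialProg (Searched f ω (t + 1)) s d := by
  refine wp_ite (fun h0 => ?_) fun h0 => ?_
  · replace h0 := of_decide_eq_true h0
    simp only [FExp.val, NExp.val] at h0
    have hd := h.draws h0
    refine wp_seq (wp_loop (fun i s' d' => d' = t * n + i ∧
      ∀ i' < i, s'.cell 3 i' 0 0 = ω (t * n + i')) ⟨by simpa using hd, by simp⟩ ?_ ?_)
    · rintro i - s' d' hA ⟨rfl, h2⟩
      rw [wp_draw]
      refine ⟨by ring, fun i' hi' => ?_⟩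
      simp only [Store.setCell, Store.setReg, NExp.val]
      grind
    · rintro s' d' hA ⟨h1, h2⟩
      rw [NExp.val, hn] at h1 h2
      have hv : boxOf f (fun l => s'.cell 3 l 0 0) =
          MvPolynomial.eval (fun i : Fin n => ω (t * n + i)) f := by
        unfold boxOf
        congr 2
        funext i
        exact h2 i i.2
      rw [wp_query]
      refine ⟨by simp [Store.setCell, NExp.val, boxOf], fun _ => by rw [h1]; ring,
        fun h0' t' ht' => ?_⟩
      rcases Nat.lt_succ_iff_lt_or_eq.1 ht' with ht' | rfl
      · exact h.zeros h0 t' ht'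
      · rw [← hv]
        simpa [Store.setCell, NExp.val] using h0'
  · replace h0 := of_decide_eq_false h0
    simp only [FExp.val, NExp.val] at h0
    exact wp_skip.2 ⟨h.value, fun h' => absurd h' h0, fun h' => absurd h' h0⟩

theorem wp_trialsProg {n t : ℕ} {f : MvPolynomial (Fin n) F} {s : Store F} {d : ℕ}
    (hn : s.reg 0 = n) (h : Searched f ω (t * (n + 2)) s d) :
    wp (boxOf f) ω trialsProg (Searched f ω ((t + 1) * (n + 2))) s d := by
  refine wp_loop (fun i s' d' => Searched f ω (t * (n + 2) + i) s' d') h ?_ ?_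
  · intro i _ s' d' hA hI
    exact wp_trialProg ((hA.reg 0 (by decide)).trans hn) (hI.congr rfl)
  · intro s' d' _ hI
    simp only [NExp.val, hn] at hI
    rwa [add_one_mul]

theorem wp_prepProg {n k : ℕ} {f : MvPolynomial (Fin n) F} {s : Store F}
    (hn : s.reg 0 = n) (hk : s.reg 1 = k) :
    wp (boxOf f) ω prepProg (Searched f ω (k * (n + 2))) s 0 := by
  refine wp_seq (wp_query.2 (wp_loop (fun i s' d' => Searched f ω (i * (n + 2)) s' d') ?_ ?_ ?_))
  · exact ⟨by simp [Store.setCell, NExp.val, boxOf], by simp, by simp⟩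
  · intro i _ s' d' hA hI
    exact wp_trialsProg ((hA.reg 0 (by decide)).trans hn) (hI.congr rfl)
  · intro s' d' _ hI
    simpa [NExp.val, Store.setCell, hk] using hI

/-- The deterministic core: preprocessing can fail only if f ≠ 0 vanishes on all k(n + 2) blocks of
the tape. -/
theorem prepProg_prepared {n k m : ℕ} {f : MvPolynomial (Fin n) F} {S : Fin (n + 2) ↪ F}
    {ω : Fin m → F}
    (hω : f ≠ 0 → ∃ t : Fin (k * (n + 2)), MvPolynomial.eval
      (fun i : Fin n => tape ω (t * n + i)) f ≠ 0) :
    Prepared f S (run (boxOf f) (tape ω) prepProg ((blank n k).load 0 (vecArray S))).toStore := by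
  set s : Store F := (blank n k).load 0 (vecArray S)
  have hA : Agree prepProg s (run (boxOf f) (tape ω) prepProg s).toStore  :=
    exec_agree prepProg ⟨s, 0, 0⟩
  have h := (wp_prepProg (f := f) (ω := tape ω) (s := s) (n := n) (k := k) rfl rfl).run
  refine ⟨hA.reg 0 (by decide), hA.cell 0 (by decide), h.value, fun h0 => ?_⟩
  by_contra hf
  obtain ⟨t, ht⟩ := hω hf
  exact ht (h.zeros h0 t t.2)

end

/-! ### The probability of failure -/

/-- Independence of the trials as a count: the tape splits into T blocks of length n, each
constrained separately, and e unconstrained entries. -/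
theorem card_forall_blocks {X : Type*} [Fintype X] {T n e : ℕ} (P : (Fin n → X) → Prop) :
    Nat.card {w : Fin (T * n + e) → X //
      ∀ t : Fin T, P fun i => w (Fin.castAdd e (finProdFinEquiv (t, i)))} =
      Nat.card {v : Fin n → X // P v} ^ T * Nat.card X ^ e := by
  let E : (Fin (T * n + e) → X) ≃ (Fin T → Fin n → X) × (Fin e → X) :=
    (Equiv.arrowCongr finSumFinEquiv.symm (Equiv.refl X)).trans
      ((Equiv.sumArrowEquivProdArrow _ _ _).trans
        (Equiv.prodCongr ((Equiv.arrowCongr finProdFinEquiv.symm (Equiv.refl X)).trans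
          (Equiv.curry _ _ _)) (Equiv.refl _)))
  have hE : ∀ w, (E w).1 = fun t i => w (Fin.castAdd e (finProdFinEquiv (t, i))) := fun w => rfl
  rw [Nat.card_congr ((E.subtypeEquiv (q := fun v => ∀ t, P (v.1 t)) fun w => by
      simp only [hE])),
    Nat.card_congr (Equiv.prodSubtypeFstEquivSubtypeProd (p := fun v : Fin T → Fin n → X =>
      ∀ t, P (v t))), Nat.card_prod, Nat.card_congr Equiv.subtypePiEquivPi, Nat.card_fun, Nat.card_fun]
  simp

/-- Bernoulli gives (1 + 2/n)^(n+2) ≥ 3 + 4/n for n > 0, so n + 2 trials of failure probability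
n/(n+2) all fail with probability at most 1/2. -/
theorem two_mul_pow_le (n : ℕ) : 2 * n ^ (n + 2) ≤ (n + 2) ^ (n + 2) := by
  rcases Nat.eq_zero_or_pos n with rfl | hn
  · norm_num
  have hn' : (0 : ℝ) < n := Nat.cast_pos.2 hn
  have h := one_add_mul_le_pow (a := (2 : ℝ) / n)
    (by have : (0 : ℝ) ≤ 2 / n := by positivity
        linarith) (n + 2)
  have h1 : (2 : ℝ) ≤ (1 + 2 / n) ^ (n + 2) := by
    refine le_trans ?_ h
    have : ((n + 2 : ℕ) : ℝ) * (2 / n) = 2 + 4 / n := by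
      push_cast
      field_simp
      ring
    rw [this]
    have : (0 : ℝ) ≤ 4 / n := by positivity
    linarith
  have h2 : (1 + 2 / (n : ℝ)) ^ (n + 2) * (n : ℝ) ^ (n + 2) = ((n : ℝ) + 2) ^ (n + 2) := by
    rw [← mul_pow]
    congr 1
    field_simp
  have h3 : 2 * (n : ℝ) ^ (n + 2) ≤ ((n : ℝ) + 2) ^ (n + 2) := by
    rw [← h2]
    gcongr
  exact_mod_cast h3

/-- Schwartz–Zippel on a grid of n + 2 nodes per coordinate, with denominators cleared. -/
theorem card_zeros_le {F : Type*} [Field F] {n : ℕ} {f : MvPolynomial (Fin n) F} (hf : f ≠ 0)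
    (hdeg : f.totalDegree ≤ n) (S : Fin (n + 2) ↪ F) :
    (n + 2) * Nat.card {v : Fin n → Fin (n + 2) // MvPolynomial.eval (fun i => S (v i)) f = 0} ≤
      n * (n + 2) ^ n := by
  classical
  have h := MvPolynomial.schwartz_zippel_totalDegree hf (Finset.univ.map S)
  rw [Finset.card_map, Finset.card_univ, Fintype.card_fin] at h
  have hcard : Nat.card {v : Fin n → Fin (n + 2) // MvPolynomial.eval (fun i => S (v i)) f = 0} ≤
      ((Fintype.piFinset fun _ => Finset.univ.map S).filter
        fun x => MvPolynomial.eval x f = 0).card := by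
    rw [← Fintype.card_coe, ← Nat.card_eq_fintype_card]
    refine Nat.card_le_card_of_injective (fun v => ⟨fun i => S (v.1 i), ?_⟩) fun v v' h' => ?_
    · simpa using v.2
    · exact Subtype.ext (funext fun i => S.injective (congrFun (congrArg Subtype.val h') i))
  rw [div_le_div_iff₀ (by positivity) (by positivity)] at h
  have h' : ((Fintype.piFinset fun _ => Finset.univ.map S).filter
      fun x => MvPolynomial.eval x f = 0).card * (n + 2) ≤ f.totalDegree * (n + 2) ^ n := by
    exact_mod_cast h
  calc _ ≤ _ := Nat.mul_le_mul_left (n + 2) hcard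
    _ ≤ _ := by rw [mul_comm]; exact h'
    _ ≤ _ := Nat.mul_le_mul_right _ hdeg

theorem drawProb_le {F : Type*} {N m : ℕ} (hN : 0 < N) (S : Fin N ↪ F) {E : (Fin m → F) → Prop}
    {B : (Fin m → Fin N) → Prop} (hB : ∀ w, ¬ B w → E fun i => S (w i)) {ε : ℝ}
    (hε : (Nat.card {w // B w} : ℝ) ≤ ε * (N : ℝ) ^ m) : 1 - ε ≤ drawProb S m E := by
  have hpos : (0 : ℝ) < (N : ℝ) ^ m := by positivity
  rw [drawProb, le_div_iff₀ hpos]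
  classical
  have h1 : N ^ m ≤ Nat.card {w // B w} + Nat.card {w : Fin m → Fin N // E fun i => S (w i)} := by
    have h2 : Nat.card {w : Fin m → Fin N // ¬ B w} ≤
        Nat.card {w : Fin m → Fin N // E fun i => S (w i)} :=
      Nat.card_le_card_of_injective (Subtype.map id hB) (Subtype.map_injective _ Function.injective_id)
    have h3 : N ^ m = Nat.card {w // B w} + Nat.card {w : Fin m → Fin N // ¬ B w} := by
      rw [← Nat.card_sum, Nat.card_congr (Equiv.sumCompl B)]
      simp
    omega
  have h1' : (N : ℝ) ^ m ≤ Nat.card {w // B w} +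
      Nat.card {w : Fin m → Fin N // E fun i => S (w i)} := by exact_mod_cast h1
  linarith

/-- The zero polynomial never causes failure. Otherwise failure requires all T = k(n + 2) blocks to
be zeros of f, which has probability at most (n/(n+2))^T ≤ 2⁻ᵏ. -/
theorem le_drawProb_prepProg {F : Type*} [Field F] [DecidableEq F] {n k m : ℕ}
    (hm : k * (n + 2) * n ≤ m) {f : MvPolynomial (Fin n) F} (hdeg : f.totalDegree ≤ n)
    (S : Fin (n + 2) ↪ F) {E : (Fin m → F) → Prop}
    (hE : ∀ ω : Fin m → F, Prepared f S
      (run (boxOf f) (tape ω) prepProg ((blank n k).load 0 (vecArray S))).toStore → E ω) :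
    1 - 1 / (2 : ℝ) ^ k ≤ drawProb S m E := by
  by_cases hf : f = 0
  · refine drawProb_le (B := fun _ => False) (by omega) S
      (fun w _ => hE _ (prepProg_prepared fun h => absurd hf h)) ?_
    simp only [Nat.card_of_isEmpty, Nat.cast_zero]
    positivity
  obtain ⟨e, rfl⟩ := Nat.exists_eq_add_of_le hm
  set T := k * (n + 2) with hT
  refine drawProb_le (B := fun w => ∀ t : Fin T, MvPolynomial.eval
    (fun i => S (w (Fin.castAdd e (finProdFinEquiv (t, i))))) f = 0) (by omega) S
    (fun w hw => hE _ (prepProg_prepared fun _ => ?_)) ?_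
  · obtain ⟨t, ht⟩ := not_forall.1 hw
    refine ⟨t, fun h => ht ?_⟩
    rw [← h]
    congr 2
    funext i
    have hi : (t : ℕ) * n + i < T * n + e := by
      have := (Fin.castAdd e (finProdFinEquiv (t, i))).2
      simp only [Fin.val_castAdd, finProdFinEquiv_apply_val] at this
      rw [mul_comm (t : ℕ)]
      omega
    rw [tape, dif_pos hi]
    congr 2
    ext
    simp [mul_comm n, add_comm]
  · rw [card_forall_blocks fun v : Fin n → Fin (n + 2) =>
      MvPolynomial.eval (fun i => S (v i)) f = 0]
    have hz := card_zeros_le hf hdeg S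
    generalize Nat.card {v : Fin n → Fin (n + 2) //
      MvPolynomial.eval (fun i => S (v i)) f = 0} = z at hz
    have h1 : (n + 2) ^ T * z ^ T ≤ n ^ T * ((n + 2) ^ n) ^ T := by
      rw [← mul_pow, ← mul_pow]
      exact Nat.pow_le_pow_left hz T
    have h2 : 2 ^ k * n ^ T ≤ (n + 2) ^ T := by
      rw [hT, mul_comm k, pow_mul, pow_mul, ← mul_pow]
      exact Nat.pow_le_pow_left (two_mul_pow_le n) k
    have h3 : 2 ^ k * z ^ T ≤ ((n + 2) ^ n) ^ T := by
      refine le_of_mul_le_mul_left (a := (n + 2) ^ T) ?_ (pow_pos (Nat.succ_pos _) _)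
      calc (n + 2) ^ T * (2 ^ k * z ^ T) = 2 ^ k * ((n + 2) ^ T * z ^ T) := by ring
        _ ≤ 2 ^ k * (n ^ T * ((n + 2) ^ n) ^ T) := Nat.mul_le_mul_left _ h1
        _ = 2 ^ k * n ^ T * ((n + 2) ^ n) ^ T := by ring
        _ ≤ _ := Nat.mul_le_mul_right _ h2
    have h4 : 2 ^ k * (z ^ T * (n + 2) ^ e) ≤ (n + 2) ^ (T * n + e) := by
      rw [← mul_assoc, pow_add, mul_comm T n, pow_mul (n + 2) n T]
      exact Nat.mul_le_mul_right _ h3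
    rw [Nat.card_fin, one_div, inv_mul_eq_div, le_div_iff₀ (by positivity), mul_comm]
    exact_mod_cast h4

end FieldRAM

/-! ### Gauss–Jordan elimination -/

namespace FieldRAM

section

variable {F : Type*} [Field F] {m : ℕ}

/-- The effect on an augmented matrix of adding `x` times row `p` to row `i`. -/
def addRow (m i p : ℕ) (x : F) (g : ℕ → ℕ → F) : ℕ → ℕ → F :=
  fun a b => if a = i ∧ b < m + m then g a b + x * g p b else g a b

/-- The augmented matrix `g` arises from `[N | 1]` by invertible row operations. -/
structure RowEquivalent (N : Matrix (Fin m) (Fin m) F) (g : ℕ → ℕ → F) : Prop where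
  eq_mul : (Matrix.of fun i j : Fin m => g i j) = (Matrix.of fun i j : Fin m => g i (m + j)) * N
  det_ne_zero : (Matrix.of fun i j : Fin m => g i j).det ≠ 0

/-- The operation is left multiplication by 1 + x e_i e_pᵀ, of determinant 1 for i ≠ p and 1 + x for
i = p. Scaling a row is thus the case i = p. -/
theorem RowEquivalent.addRow {N : Matrix (Fin m) (Fin m) F} {g : ℕ → ℕ → F}
    (h : RowEquivalent N g) {i p : ℕ} (hi : i < m) (hp : p < m) {x : F}
    (hx : i ≠ p ∨ 1 + x ≠ 0) : RowEquivalent N (addRow m i p x g) := by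
  set E : Matrix (Fin m) (Fin m) F := 1 + vecMulVec (Pi.single ⟨i, hi⟩ 1) (Pi.single ⟨p, hp⟩ x)
  have hE : ∀ M : Matrix (Fin m) (Fin m) F, E * M = Matrix.of fun a b : Fin m =>
      if (a : ℕ) = i then M a b + x * M ⟨p, hp⟩ b else M a b := fun M => by
    rw [add_mul, one_mul, vecMulVec_mul]
    ext a b
    by_cases ha : (a : ℕ) = i
    · have ha' : a = ⟨i, hi⟩ := Fin.ext ha
      simp [vecMulVec_apply, single_vecMul, ha']
    · have ha' : a ≠ ⟨i, hi⟩ := fun h => ha (congrArg Fin.val h)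
      simp [vecMulVec_apply, ha, ha']
  have hdet : E.det ≠ 0 := by
    rw [det_one_add_vecMulVec, dotProduct_single, mul_one]
    by_cases hip : i = p
    · subst hip
      simpa using hx
    · have hip' : (⟨i, hi⟩ : Fin m) ≠ ⟨p, hp⟩ := fun h => hip (congrArg Fin.val h)
      simp [Pi.single_eq_of_ne hip']
  have hL : (Matrix.of fun a b : Fin m => FieldRAM.addRow m i p x g a b) =
      E * Matrix.of fun a b : Fin m => g a b := by
    rw [hE]
    ext a b
    have hb : (b : ℕ) < m + m := by omega
    simp [FieldRAM.addRow, hb]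
  have hR : (Matrix.of fun a b : Fin m => FieldRAM.addRow m i p x g a (m + b)) =
      E * Matrix.of fun a b : Fin m => g a (m + b) := by
    rw [hE]
    ext a b
    simp [FieldRAM.addRow]
  exact ⟨by rw [hL, hR, h.eq_mul, Matrix.mul_assoc],
    by rw [hL, det_mul]; exact mul_ne_zero hdet h.det_ne_zero⟩

/-- The first `c` columns of `g` are those of the identity matrix. -/
def ColumnsReduced (m c : ℕ) (g : ℕ → ℕ → F) : Prop :=
  ∀ i < m, ∀ j < c, g i j = if i = j then 1 else 0

theorem RowEquivalent.exists_ne_zero {N : Matrix (Fin m) (Fin m) F} {g : ℕ → ℕ → F}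
    (h : RowEquivalent N g) {c : ℕ} (hc : c < m) (hg : ColumnsReduced m c g) :
    ∃ q, c ≤ q ∧ q < m ∧ g q c ≠ 0 := by
  by_contra! hq
  -- Without a pivot, column c is the combination of the first c unit columns with its own entries
  -- as coefficients; this relation is a kernel vector.
  refine h.det_ne_zero (exists_mulVec_eq_zero_iff.1 ⟨fun j =>
    if (j : ℕ) < c then g j c else if (j : ℕ) = c then -1 else 0, ?_, ?_⟩)
  · intro h0
    have := congrFun h0 ⟨c, hc⟩
    simp at this
  · ext i
    simp only [mulVec, dotProduct, of_apply, Pi.zero_apply]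
    have hterm : ∀ j : Fin m, g i j * (if (j : ℕ) < c then g j c else
        if (j : ℕ) = c then -1 else 0) =
        (if j = i then if (i : ℕ) < c then g i c else 0 else 0) -
          if j = ⟨c, hc⟩ then g i c else 0 := fun j => by
      rcases lt_trichotomy (j : ℕ) c with hj | hj | hj
      · have hj' : j ≠ ⟨c, hc⟩ := fun h => hj.ne (congrArg Fin.val h)
        have := hg i i.2 j hj
        by_cases hji : j = i
        · subst hji
          simp [hj, hj', this]
        · have hij : (i : ℕ) ≠ j := fun h => hji (Fin.ext h.symm)
          simp [hj, hj', hji, this, hij]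
      · have hj' : j = ⟨c, hc⟩ := Fin.ext hj
        subst hj'
        by_cases hji : (⟨c, hc⟩ : Fin m) = i
        · subst hji
          simp
        · simp [hji]
      · have hj' : j ≠ ⟨c, hc⟩ := fun h => hj.ne' (congrArg Fin.val h)
        have h1 : ¬ (j : ℕ) < c := by omega
        have h2 : (j : ℕ) ≠ c := by omega
        by_cases hji : j = i
        · subst hji
          simp [h1, h2, hj']
        · simp [h1, h2, hj', hji]
    rw [Finset.sum_congr rfl fun j _ => hterm j, Finset.sum_sub_distrib, Finset.sum_ite_eq',
      Finset.sum_ite_eq']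
    by_cases hi : (i : ℕ) < c
    · simp [hi]
    · simp [hi, hq i (by omega) i.2]

theorem RowEquivalent.mul_eq_one {N : Matrix (Fin m) (Fin m) F} {g : ℕ → ℕ → F}
    (h : RowEquivalent N g) (hg : ColumnsReduced m m g) :
    (Matrix.of fun i j : Fin m => g i (m + j)) * N = 1 := by
  rw [← h.eq_mul]
  ext i j
  rw [of_apply, hg i i.2 j j.2, one_apply]
  simp only [Fin.ext_iff]

end

/-- The order of the bordered matrix. -/
abbrev order : NExp := .add (.reg 1) (.reg 0)

/-- Add array `5` times row `[7]` to row `[6]`. -/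
def addRowProg : Prog :=
  .loop 8 (.add order order) (.setCell 3 (.reg 6) (.reg 8) (.const 0)
    (.add (.cell 3 (.reg 6) (.reg 8) (.const 0))
      (.mul (scalar 5) (.cell 3 (.reg 7) (.reg 8) (.const 0)))))

/-- Add `x` times row `p` to row `i`. -/
def addRowOf (i p : ℕ) (x : FExp) : Prog :=
  .seq (.setReg 6 (.reg i)) (.seq (.setReg 7 (.reg p)) (.seq (setScalar 5 x) addRowProg))

def pivotProg : Prog :=
  .loop 3 order (.ite (.natLt (.reg 2) (.reg 3))
    (.ite (.fieldEq (.cell 3 (.reg 2) (.reg 2) (.const 0)) .zero) (addRowOf 2 3 .one) .skip)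
    .skip)

def normalizeProg : Prog :=
  addRowOf 2 2 (.sub (.div .one (.cell 3 (.reg 2) (.reg 2) (.const 0))) .one)

def eliminateProg : Prog :=
  .loop 3 order (.ite (.natEq (.reg 3) (.reg 2)) .skip
    (addRowOf 3 2 (.sub .zero (.cell 3 (.reg 3) (.reg 2) (.const 0)))))

/-- Gauss–Jordan elimination of the augmented matrix in array `3`. -/
def gaussProg : Prog :=
  .loop 2 order (.seq pivotProg (.seq normalizeProg eliminateProg))

/-- The augmented matrix in array `3`. -/
def augmented {F : Type*} (s : Store F) : ℕ → ℕ → F := fun i j => s.cell 3 i j 0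

/-! ### Correctness of the elimination program -/

section

variable {F : Type*} [Field F] [DecidableEq F] {O : (ℕ → F) → F} {ω : ℕ → F} {m : ℕ}

theorem wp_addRowProg {s : Store F} {d : ℕ} (hm : s.reg 1 + s.reg 0 = m) :
    wp O ω addRowProg (fun s' _ =>
      augmented s' = addRow m (s.reg 6) (s.reg 7) (s.cell 5 0 0 0) (augmented s)) s d := by
  refine wp_loop (fun t s' _ => augmented s' = fun a b => if a = s.reg 6 ∧ b < t then
    augmented s a b + s.cell 5 0 0 0 * augmented s (s.reg 7) b else augmented s a b) (by simp) ?_ ?_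
  · intro j _ s' d' hA hI
    have r6 : s'.reg 6 = s.reg 6 := hA.reg 6 (by decide)
    have r7 : s'.reg 7 = s.reg 7 := hA.reg 7 (by decide)
    have e5 : s'.cell 5 = s.cell 5 := hA.cell 5 (by decide)
    have h6 := congrFun (congrFun hI (s.reg 6)) j
    -- Column j is still untouched in both rows, so the rows may coincide.
    have h7 := congrFun (congrFun hI (s.reg 7)) j
    rw [wp_setCell]
    funext a b
    have hab := congrFun (congrFun hI a) b
    simp only [augmented, Store.setCell, Store.setReg, NExp.val, FExp.val] at hab h6 h7 ⊢
    grind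
  · intro s' _ _ hI
    simp only [NExp.val, hm] at hI
    exact hI

/-- The coefficient is saved before the row changes, since normalization and elimination read it
from the very row they modify. Register 6 is written before register p is read, hence p ≠ 6. -/
theorem wp_addRowOf {i p : ℕ} {x : FExp} {s : Store F} {d : ℕ} (hm : s.reg 1 + s.reg 0 = m)
    (hp : p ≠ 6) (hx : x.val ((s.setReg 6 (s.reg i)).setReg 7 (s.reg p)) = x.val s) :
    wp O ω (addRowOf i p x) (fun s' _ =>
      augmented s' = addRow m (s.reg i) (s.reg p) (x.val s) (augmented s)) s d := by
  refine wp_seq (wp_setReg.2 (wp_seq (wp_setReg.2 (wp_seq (wp_setCell.2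
    ((wp_addRowProg (m := m) ?_).mono fun s' _ _ h => ?_))))))
  · simpa [Store.setCell, Store.setReg] using hm
  · rw [h]
    simp [Store.setCell, Store.setReg, NExp.val, hp] at hx ⊢
    rw [hx]
    congr 1

/-- Instead of a swap, lower rows are added to row c while its pivot is zero. They vanish in the
earlier columns, so these stay reduced. A pivot that remains zero would mean that column c vanishes
from row c on, contrary to invertibility. -/
theorem wp_pivotProg {N : Matrix (Fin m) (Fin m) F} {s : Store F} {d : ℕ}
    (hm : s.reg 1 + s.reg 0 = m) (hc : s.reg 2 < m) (h : RowEquivalent N (augmented s))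
    (hg : ColumnsReduced m (s.reg 2) (augmented s)) :
    wp O ω pivotProg (fun s' _ => RowEquivalent N (augmented s') ∧
      ColumnsReduced m (s.reg 2) (augmented s') ∧
        augmented s' (s.reg 2) (s.reg 2) ≠ 0) s d := by
  refine wp_loop (fun t s' _ => RowEquivalent N (augmented s') ∧
      ColumnsReduced m (s.reg 2) (augmented s') ∧ (augmented s' (s.reg 2) (s.reg 2) = 0 →
        ∀ q, s.reg 2 < q → q < t → augmented s' q (s.reg 2) = 0)) ⟨h, hg, by simp⟩ ?_ ?_
  · rintro q hq s' d' hA ⟨h1, h2, h3⟩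
    have r0 : s'.reg 0 = s.reg 0 := hA.reg 0 (by decide)
    have r1 : s'.reg 1 = s.reg 1 := hA.reg 1 (by decide)
    have r2 : s'.reg 2 = s.reg 2 := hA.reg 2 (by decide)
    have hq' : q < m := by simpa [NExp.val, hm] using hq
    refine wp_ite (fun hlt => wp_ite (fun h0 => ?_) fun h0 => wp_skip.2 ?_) fun hlt => wp_skip.2 ?_
    · replace hlt := of_decide_eq_true hlt
      replace h0 := of_decide_eq_true h0
      simp only [NExp.val, FExp.val, Store.setReg, r2] at hlt h0
      simp at hlt
      refine (wp_addRowOf (m := m) (by simpa [Store.setReg, r0, r1] using hm) (by decide)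
        rfl).mono fun s'' _ _ h'' => ?_
      have haug : augmented (s'.setReg 3 q) = augmented s' := rfl
      rw [haug] at h''
      have e2 : (s'.setReg 3 q).reg 2 = s.reg 2 := r2
      have e3 : (s'.setReg 3 q).reg 3 = q := rfl
      rw [e2, e3, FExp.val] at h''
      rw [h'']
      refine ⟨h1.addRow hc hq' (Or.inl hlt.ne), fun i hi j hj => ?_, fun hz q' hq1 hq2 => ?_⟩
      · have ha := h2 i hi j hj
        have hb := h2 q hq' j hj
        simp only [addRow]
        grind
      · simp only [addRow] at hz ⊢
        have h3' := h3 h0 q' hq1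
        have h0' : augmented s' (s.reg 2) (s.reg 2) = 0 := h0
        have : q' ≠ s.reg 2 := by omega
        simp only [this, false_and, if_false]
        grind
    · replace h0 := of_decide_eq_false h0
      simp only [NExp.val, FExp.val, Store.setReg, r2] at h0
      exact ⟨h1, h2, fun hz => absurd hz h0⟩
    · replace hlt := of_decide_eq_false hlt
      simp [NExp.val, Store.setReg, r2] at hlt
      refine ⟨h1, h2, fun hz q' hq1 hq2 => h3 hz q' hq1 (by omega)⟩
  · rintro s' d' - ⟨h1, h2, h3⟩
    refine ⟨h1, h2, fun hz => ?_⟩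
    obtain ⟨q, hq1, hq2, hq3⟩ := h1.exists_ne_zero hc h2
    rcases hq1.eq_or_lt with rfl | hq1
    · exact hq3 hz
    · exact hq3 (h3 hz q hq1 (by simpa [NExp.val, hm] using hq2))

theorem wp_normalizeProg {N : Matrix (Fin m) (Fin m) F} {s : Store F} {d : ℕ}
    (hm : s.reg 1 + s.reg 0 = m) (hc : s.reg 2 < m) (h : RowEquivalent N (augmented s))
    (hg : ColumnsReduced m (s.reg 2) (augmented s))
    (h0 : augmented s (s.reg 2) (s.reg 2) ≠ 0) :
    wp O ω normalizeProg (fun s' _ => RowEquivalent N (augmented s') ∧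
      ColumnsReduced m (s.reg 2) (augmented s') ∧
        augmented s' (s.reg 2) (s.reg 2) = 1) s d := by
  refine (wp_addRowOf hm (by decide) (by simp [FExp.val, NExp.val, Store.setReg])).mono
    fun s' _ _ h' => ?_
  have hx : FExp.val s (.sub (.div .one (.cell 3 (.reg 2) (.reg 2) (.const 0))) .one) =
      1 / augmented s (s.reg 2) (s.reg 2) - 1 := rfl
  rw [hx] at h'
  rw [h']
  -- The coefficient is 1/g - 1 for the pivot g, so the row is scaled by 1/g ≠ 0.
  refine ⟨h.addRow hc hc (Or.inr (by simpa using h0)), fun i hi j hj => ?_, ?_⟩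
  · have ha := hg i hi j hj
    have hb := hg (s.reg 2) hc j hj
    simp only [addRow]
    grind
  · have : s.reg 2 < m + m := by omega
    simp only [addRow, this, and_self, if_true]
    field_simp
    ring

theorem wp_eliminateProg {N : Matrix (Fin m) (Fin m) F} {s : Store F} {d : ℕ}
    (hm : s.reg 1 + s.reg 0 = m) (hc : s.reg 2 < m) (h : RowEquivalent N (augmented s))
    (hg : ColumnsReduced m (s.reg 2) (augmented s))
    (h1 : augmented s (s.reg 2) (s.reg 2) = 1) :
    wp O ω eliminateProg (fun s' _ => RowEquivalent N (augmented s') ∧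
      ColumnsReduced m (s.reg 2 + 1) (augmented s')) s d := by
  refine wp_loop (fun t s' _ => RowEquivalent N (augmented s') ∧
    ColumnsReduced m (s.reg 2) (augmented s') ∧ augmented s' (s.reg 2) (s.reg 2) = 1 ∧
      ∀ q < t, q ≠ s.reg 2 → augmented s' q (s.reg 2) = 0) ⟨h, hg, h1, by simp⟩ ?_ ?_
  · rintro q hq s' d' hA ⟨h1, h2, h3, h4⟩
    have r0 : s'.reg 0 = s.reg 0 := hA.reg 0 (by decide)
    have r1 : s'.reg 1 = s.reg 1 := hA.reg 1 (by decide)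
    have r2 : s'.reg 2 = s.reg 2 := hA.reg 2 (by decide)
    have hq' : q < m := by simpa [NExp.val, hm] using hq
    refine wp_ite (fun h0 => wp_skip.2 ?_) fun h0 => ?_
    · replace h0 := of_decide_eq_true h0
      simp [NExp.val, Store.setReg, r2] at h0
      exact ⟨h1, h2, h3, fun q' hq1 hq2 => h4 q' (by omega) hq2⟩
    · replace h0 := of_decide_eq_false h0
      simp [NExp.val, Store.setReg, r2] at h0
      refine (wp_addRowOf (m := m) (by simpa [Store.setReg, r0, r1] using hm) (by decide)
        (by simp [FExp.val, NExp.val, Store.setReg])).mono fun s'' _ _ h'' => ?_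
      have haug : augmented (s'.setReg 3 q) = augmented s' := rfl
      have e2 : (s'.setReg 3 q).reg 2 = s.reg 2 := r2
      have e3 : (s'.setReg 3 q).reg 3 = q := rfl
      have hx : FExp.val (s'.setReg 3 q) (.sub .zero (.cell 3 (.reg 3) (.reg 2) (.const 0))) =
          0 - augmented s' q (s.reg 2) := by
        rw [← r2]
        rfl
      rw [haug, e2, e3, hx] at h''
      rw [h'']
      have hc' : s.reg 2 < m + m := by omega
      refine ⟨h1.addRow hq' hc (Or.inl h0), fun i hi j hj => ?_, ?_, fun q' hq1 hq2 => ?_⟩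
      · have ha := h2 i hi j hj
        have hb := h2 (s.reg 2) hc j hj
        simp only [addRow]
        grind
      · simp only [addRow]
        grind
      · have := h4 q'
        simp only [addRow]
        grind
  · rintro s' d' - ⟨h1, h2, h3, h4⟩
    refine ⟨h1, fun i hi j hj => ?_⟩
    simp only [NExp.val, hm] at h4
    have := h2 i hi j
    have := h4 i hi
    grind

theorem wp_gaussProg {N : Matrix (Fin m) (Fin m) F} {s : Store F} {d : ℕ}
    (hm : s.reg 1 + s.reg 0 = m) (h : RowEquivalent N (augmented s)) :
    wp O ω gaussProg (fun s' _ =>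
      (Matrix.of fun i j : Fin m => augmented s' i (m + j)) * N = 1) s d := by
  refine wp_loop (fun t s' _ => RowEquivalent N (augmented s') ∧
    ColumnsReduced m t (augmented s')) ⟨h, by simp [ColumnsReduced]⟩ ?_ ?_
  · rintro c hc s' d' hA ⟨h1, h2⟩
    have hm' : s'.reg 1 + s'.reg 0 = m := by
      rw [hA.reg 0 (by decide), hA.reg 1 (by decide), hm]
    have hc' : c < m := by simpa [NExp.val, hm] using hc
    refine wp_seq ((wp_pivotProg (m := m) (s := s'.setReg 2 c) hm' hc' h1 h2).mono
      fun s₁ _ hA₁ h₁ => ?_)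
    have q2 : s₁.reg 2 = c := hA₁.reg 2 (by decide)
    have qm : s₁.reg 1 + s₁.reg 0 = m := by
      rw [hA₁.reg 0 (by decide), hA₁.reg 1 (by decide)]
      exact hm'
    have e2 : (s'.setReg 2 c).reg 2 = c := rfl
    rw [e2, ← q2] at h₁
    refine wp_seq ((wp_normalizeProg qm (by rwa [q2]) h₁.1 h₁.2.1 h₁.2.2).mono
      fun s₂ _ hA₂ h₂ => ?_)
    have t2 : s₂.reg 2 = c := (hA₂.reg 2 (by decide)).trans q2
    have tm : s₂.reg 1 + s₂.reg 0 = m := by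
      rw [hA₂.reg 0 (by decide), hA₂.reg 1 (by decide)]
      exact qm
    rw [q2, ← t2] at h₂
    refine (wp_eliminateProg tm (by rwa [t2]) h₂.1 h₂.2.1 h₂.2.2).mono fun s₃ _ _ h₃ => ?_
    rwa [t2] at h₃
  · rintro s' _ - ⟨h1, h2⟩
    simp only [NExp.val, hm] at h2
    exact h1.mul_eq_one h2

end

end FieldRAM

/-! ### Recovery of `A` from a representation of `det (A + Y)` -/

namespace FieldRAM

/-- The matrix that the input holds in slice `[2] + 1`. -/
abbrev inputEntry (i j : NExp) : FExp := .cell 1 (.add (.reg 2) (.const 1)) i j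

/-- Write the column `[4]` and the row `[3]` of an input matrix to the border. -/
def copyProg : Prog :=
  .loop 5 (.reg 1)
    (.seq (.setCell 3 (.reg 5) (.add (.reg 1) (.reg 2)) (.const 0) (inputEntry (.reg 5) (.reg 4)))
      (.setCell 3 (.add (.reg 1) (.reg 2)) (.reg 5) (.const 0) (.sub .zero
        (.div (inputEntry (.reg 3) (.reg 5)) (inputEntry (.reg 3) (.reg 4))))))

def factorRowProg : Prog :=
  .loop 4 (.reg 1) (.ite (.fieldEq (inputEntry (.reg 3) (.reg 4)) .zero) .skip copyProg)

/-- Factor the rank-one matrix in slice `[2] + 1` of the input. -/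
def factorProg : Prog := .loop 3 (.reg 1) factorRowProg

def factorsProg : Prog := .loop 2 (.reg 0) factorProg

def blockProg : Prog :=
  .loop 2 (.reg 1) (.loop 3 (.reg 1)
    (.setCell 3 (.reg 2) (.reg 3) (.const 0) (.cell 1 (.const 0) (.reg 2) (.reg 3))))

def unitProg : Prog :=
  .loop 2 order (.setCell 3 (.reg 2) (.add order (.reg 2)) (.const 0) .one)

def outputProg : Prog :=
  .loop 2 (.reg 0) (.loop 3 (.reg 0) (.setCell 2 (.reg 2) (.reg 3) (.const 0)
    (.cell 3 (.add (.reg 1) (.reg 2)) (.add order (.add (.reg 1) (.reg 3))) (.const 0))))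

/-- Compute a matrix with prescribed principal minors. -/
def convProg : Prog :=
  .seq blockProg (.seq unitProg (.seq factorsProg (.seq gaussProg outputProg)))

/-- The border entries with index `l` of `g` factor the matrix `B`. -/
def Factored {F : Type*} [Field F] (r l : ℕ) (B g : ℕ → ℕ → F) : Prop :=
  ∀ k < r, ∀ k' < r, B k k' = -(g k (r + l) * g (r + l) k')

/-- The arrays agree outside of the border entries with index `l`. -/
def AgreeOutside {F : Type*} (r l : ℕ) (g g' : ℕ → ℕ → F) : Prop :=
  ∀ i j, ¬ (i < r ∧ j = r + l) → ¬ (i = r + l ∧ j < r) → g' i j = g i j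

/-! ### Correctness of the conversion program -/

section

variable {F : Type*} [Field F] [DecidableEq F] {O : (ℕ → F) → F} {ω : ℕ → F}

theorem wp_copyProg {s : Store F} {d : ℕ} : wp O ω copyProg (fun s' _ =>
    (∀ k < s.reg 1, augmented s' k (s.reg 1 + s.reg 2) = s.cell 1 (s.reg 2 + 1) k (s.reg 4) ∧
      augmented s' (s.reg 1 + s.reg 2) k = 0 - s.cell 1 (s.reg 2 + 1) (s.reg 3) k /
        s.cell 1 (s.reg 2 + 1) (s.reg 3) (s.reg 4)) ∧
    AgreeOutside (s.reg 1) (s.reg 2) (augmented s) (augmented s')) s d := by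
  refine wp_loop (fun t s' _ =>
    (∀ k < t, augmented s' k (s.reg 1 + s.reg 2) = s.cell 1 (s.reg 2 + 1) k (s.reg 4) ∧
      augmented s' (s.reg 1 + s.reg 2) k = 0 - s.cell 1 (s.reg 2 + 1) (s.reg 3) k /
        s.cell 1 (s.reg 2 + 1) (s.reg 3) (s.reg 4)) ∧
    AgreeOutside (s.reg 1) (s.reg 2) (augmented s) (augmented s')) ⟨by simp, fun _ _ _ _ => rfl⟩ ?_
    fun _ _ _ h => h
  rintro k hk s' d' hA ⟨h1, h2⟩
  have hk' : k < s.reg 1 := hk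
  have r1 : s'.reg 1 = s.reg 1 := hA.reg 1 (by decide)
  have r2 : s'.reg 2 = s.reg 2 := hA.reg 2 (by decide)
  have r3 : s'.reg 3 = s.reg 3 := hA.reg 3 (by decide)
  have r4 : s'.reg 4 = s.reg 4 := hA.reg 4 (by decide)
  have e1 : s'.cell 1 = s.cell 1 := hA.cell 1 (by decide)
  refine wp_seq (wp_setCell.2 (wp_setCell.2 ⟨fun q hq => ?_, fun i j hi hj => ?_⟩))
  · have := h1 q
    simp only [augmented, Store.setCell, Store.setReg, NExp.val, FExp.val] at this ⊢
    simp [r1, r2, r3, r4, e1]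
    grind
  · have := h2 i j hi hj
    simp only [augmented, Store.setCell, Store.setReg, NExp.val, FExp.val] at this ⊢
    simp [r1, r2, r3, r4, e1]
    grind

/-- The vanishing 2 × 2 minors give B k k' = B k j · (B i k' / B i j) at any nonzero entry B i j.
The border is rewritten at each such entry, and every rewriting is again a factorization. -/
theorem wp_factorProg {s : Store F} {d r l : ℕ} {B : ℕ → ℕ → F} (hr : s.reg 1 = r)
    (hl : s.reg 2 = l) (hB : s.cell 1 (l + 1) = B)
    (hminor : ∀ i < r, ∀ j < r, ∀ k < r, ∀ k' < r, B k k' * B i j = B k j * B i k')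
    (hne : ∃ i < r, ∃ j < r, B i j ≠ 0) :
    wp O ω factorProg (fun s' _ => Factored r l B (augmented s') ∧
      AgreeOutside r l (augmented s) (augmented s')) s d := by
  refine wp_loop (fun t s' _ => AgreeOutside r l (augmented s) (augmented s') ∧
    (Factored r l B (augmented s') ∨ ∀ i < t, ∀ j < r, B i j = 0))
    ⟨fun _ _ _ _ => rfl, by simp⟩ ?_ ?_
  · rintro i hi s₁ d₁ hA₁ ⟨h1, h2⟩
    have hi' : i < r := by rw [← hr]; exact hi
    have q1 : s₁.reg 1 = r := (hA₁.reg 1 (by decide)).trans hr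
    have q2 : s₁.reg 2 = l := (hA₁.reg 2 (by decide)).trans hl
    have f1 : s₁.cell 1 (l + 1) = B := by rw [hA₁.cell 1 (by decide), hB]
    refine wp_loop (fun t s' _ => AgreeOutside r l (augmented s) (augmented s') ∧
      (Factored r l B (augmented s') ∨
        (∀ i' < i, ∀ j < r, B i' j = 0) ∧ ∀ j < t, B i j = 0))
      ⟨h1, h2.imp_right fun h => ⟨h, by simp⟩⟩ ?_ ?_
    · rintro j hj s₂ d₂ hA₂ ⟨h3, h4⟩
      have hj' : j < r := by rw [← q1]; exact hj
      have t1 : s₂.reg 1 = r := (hA₂.reg 1 (by decide)).trans q1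
      have t2 : s₂.reg 2 = l := (hA₂.reg 2 (by decide)).trans q2
      have t3 : s₂.reg 3 = i := hA₂.reg 3 (by decide)
      have g1 : s₂.cell 1 (l + 1) = B := by
        rw [← f1]
        exact congrFun (hA₂.cell 1 (by decide)) (l + 1)
      have hcell : (s₂.setReg 4 j).cell 1 ((s₂.setReg 4 j).reg 2 + 1) = B := by
        rw [← g1, ← t2]
        rfl
      have u1 : (s₂.setReg 4 j).reg 1 = r := t1
      have u2 : (s₂.setReg 4 j).reg 2 = l := t2
      have u3 : (s₂.setReg 4 j).reg 3 = i := t3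
      have u4 : (s₂.setReg 4 j).reg 4 = j := rfl
      refine wp_ite (fun h0 => wp_skip.2 ⟨h3, ?_⟩) fun h0 => wp_copyProg.mono
        fun s₃ _ _ h₃ => ?_
      · replace h0 := of_decide_eq_true h0
        simp only [FExp.val, NExp.val, hcell, u3, u4] at h0
        refine h4.imp_right fun h => ⟨h.1, fun j' hj' => ?_⟩
        rcases Nat.lt_succ_iff_lt_or_eq.1 hj' with hj' | rfl
        exacts [h.2 j' hj', h0]
      · replace h0 := of_decide_eq_false h0
        simp only [FExp.val, NExp.val, hcell, u3, u4] at h0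
        rw [hcell, u1, u2, u3, u4] at h₃
        have haug : augmented (s₂.setReg 4 j) = augmented s₂ := rfl
        rw [haug] at h₃
        refine ⟨fun a b ha hb => (h₃.2 a b ha hb).trans (h3 a b ha hb), Or.inl fun k hk k' hk' => ?_⟩
        rw [(h₃.1 k hk).1, (h₃.1 k' hk').2]
        have := hminor i hi' j hj' k hk k' hk'
        field_simp
        linear_combination this
    · rintro s₂ d₂ - ⟨h3, h4⟩
      refine ⟨h3, h4.imp_right fun h i' hi'' => ?_⟩
      rcases Nat.lt_succ_iff_lt_or_eq.1 hi'' with hi'' | rfl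
      · exact h.1 i' hi''
      · intro j hj
        exact h.2 j (by rw [← q1] at hj; exact hj)
  · rintro s₁ d₁ - ⟨h1, h2⟩
    refine ⟨h2.resolve_right fun h => ?_, h1⟩
    obtain ⟨i, hi, j, hj, hij⟩ := hne
    exact hij (h i (by rw [← hr] at hi; exact hi) j hj)

/-- Different l use disjoint border entries, so earlier factorizations survive; the two diagonal
blocks and the right half of the augmented matrix are not touched. -/
theorem wp_factorsProg {s : Store F} {d n r : ℕ} (hn : s.reg 0 = n) (hr : s.reg 1 = r)
    (hminor : ∀ l < n, ∀ i < r, ∀ j < r, ∀ k < r, ∀ k' < r,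
      s.cell 1 (l + 1) k k' * s.cell 1 (l + 1) i j = s.cell 1 (l + 1) k j * s.cell 1 (l + 1) i k')
    (hne : ∀ l < n, ∃ i < r, ∃ j < r, s.cell 1 (l + 1) i j ≠ 0) :
    wp O ω factorsProg (fun s' _ => (∀ l < n, Factored r l (s.cell 1 (l + 1)) (augmented s')) ∧
      ∀ i j, (i < r ↔ j < r) ∨ r + n ≤ j → augmented s' i j = augmented s i j) s d := by
  refine wp_loop (fun t s' _ => (∀ l < t, Factored r l (s.cell 1 (l + 1)) (augmented s')) ∧
      ∀ i j, (i < r ↔ j < r) ∨ r + n ≤ j → augmented s' i j = augmented s i j) (by simp) ?_ ?_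
  · rintro l hl s₁ d₁ hA₁ ⟨h1, h2⟩
    have hl' : l < n := by rw [← hn]; exact hl
    have q1 : s₁.reg 1 = r := (hA₁.reg 1 (by decide)).trans hr
    refine (wp_factorProg (r := r) (l := l) (s := s₁.setReg 2 l) q1 rfl (congrFun (hA₁.cell 1 (by decide)) (l + 1))
      (hminor l hl') (hne l hl')).mono fun s₂ _ _ h₂ => ?_
    have haug : augmented (s₁.setReg 2 l) = augmented s₁ := rfl
    rw [haug] at h₂
    refine ⟨fun l' hl' k hk k' hk' => ?_, fun i j hij => ?_⟩
    · rcases Nat.lt_succ_iff_lt_or_eq.1 hl' with hl' | rfl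
      · rw [h₂.2 k (r + l') (by omega) (by omega), h₂.2 (r + l') k' (by omega) (by omega)]
        exact h1 l' hl' k hk k' hk'
      · exact h₂.1 k hk k' hk'
    · rw [h₂.2 i j (by omega) (by omega)]
      exact h2 i j hij
  · rintro s' _ - ⟨h1, h2⟩
    exact ⟨fun l hl => h1 l (by rw [← hn] at hl; exact hl), h2⟩

theorem wp_blockProg {s : Store F} {d r : ℕ} (hr : s.reg 1 = r) :
    wp O ω blockProg (fun s' _ => augmented s' = fun i j =>
      if i < r ∧ j < r then s.cell 1 0 i j else augmented s i j) s d := by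
  refine wp_loop (fun t s' _ => augmented s' = fun i j =>
      if i < t ∧ j < r then s.cell 1 0 i j else augmented s i j) (by simp) ?_ ?_
  · intro i _ s₁ d₁ hA₁ h₁
    have q1 : s₁.reg 1 = r := (hA₁.reg 1 (by decide)).trans hr
    have f1 : s₁.cell 1 = s.cell 1 := hA₁.cell 1 (by decide)
    refine wp_loop (fun t s' _ => augmented s' = fun i' j =>
      if (i' < i ∧ j < r) ∨ (i' = i ∧ j < t) then s.cell 1 0 i' j else augmented s i' j)
      (by change augmented s₁ = _; rw [h₁]; simp) ?_ ?_
    · intro j _ s₂ d₂ hA₂ h₂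
      have t2 : s₂.reg 2 = i := hA₂.reg 2 (by decide)
      have g1 : s₂.cell 1 = s.cell 1 := (hA₂.cell 1 (by decide)).trans f1
      rw [wp_setCell]
      funext a b
      have := congrFun (congrFun h₂ a) b
      simp only [augmented, Store.setCell, Store.setReg, NExp.val, FExp.val] at this ⊢
      grind
    · intro s₂ d₂ _ h₂
      rw [h₂]
      funext a b
      have : NExp.val (s₁.setReg 2 i).reg (.reg 1) = r := q1
      rw [this]
      grind
  · intro s' _ _ h'
    have he : NExp.val s.reg (.reg 1) = r := hr
    rwa [he] at h'

theorem wp_unitProg {s : Store F} {d m : ℕ} (hm : s.reg 1 + s.reg 0 = m) :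
    wp O ω unitProg (fun s' _ => augmented s' = fun i j =>
      if i < m ∧ j = m + i then 1 else augmented s i j) s d := by
  refine wp_loop (fun t s' _ => augmented s' = fun i j =>
      if i < t ∧ j = m + i then 1 else augmented s i j) (by simp) ?_ ?_
  · intro i _ s₁ d₁ hA₁ h₁
    have q : s₁.reg 1 + s₁.reg 0 = m := by
      rw [hA₁.reg 0 (by decide), hA₁.reg 1 (by decide), hm]
    rw [wp_setCell]
    funext a b
    have := congrFun (congrFun h₁ a) b
    simp only [augmented, Store.setCell, Store.setReg, NExp.val, FExp.val] at this ⊢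
    grind
  · intro s' _ _ h'
    simpa [NExp.val, hm] using h'

theorem wp_outputProg {s : Store F} {d n r m : ℕ} (hn : s.reg 0 = n) (hr : s.reg 1 = r)
    (hm : r + n = m) : wp O ω outputProg (fun s' _ => ∀ i < n, ∀ j < n,
      s'.cell 2 i j 0 = augmented s (r + i) (m + (r + j))) s d := by
  refine wp_loop (fun t s' _ => ∀ i < t, ∀ j < n,
    s'.cell 2 i j 0 = augmented s (r + i) (m + (r + j))) (by simp) ?_ ?_
  · intro i _ s₁ d₁ hA₁ h₁
    have q0 : s₁.reg 0 = n := (hA₁.reg 0 (by decide)).trans hn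
    have q1 : s₁.reg 1 = r := (hA₁.reg 1 (by decide)).trans hr
    have f3 : s₁.cell 3 = s.cell 3 := hA₁.cell 3 (by decide)
    refine wp_loop (fun t s' _ =>
      (∀ i' < i, ∀ j < n, s'.cell 2 i' j 0 = augmented s (r + i') (m + (r + j))) ∧
        ∀ j < t, s'.cell 2 i j 0 = augmented s (r + i) (m + (r + j))) ⟨h₁, by simp⟩ ?_ ?_
    · rintro j _ s₂ d₂ hA₂ ⟨h2, h3⟩
      have t0 : s₂.reg 0 = n := (hA₂.reg 0 (by decide)).trans q0
      have t1 : s₂.reg 1 = r := (hA₂.reg 1 (by decide)).trans q1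
      have t2 : s₂.reg 2 = i := hA₂.reg 2 (by decide)
      have g3 : s₂.cell 3 = s.cell 3 := (hA₂.cell 3 (by decide)).trans f3
      rw [wp_setCell]
      simp only [augmented, Store.setCell, Store.setReg, NExp.val, FExp.val] at h2 h3 ⊢
      simp [t0, t1, t2, g3, hm]
      grind
    · rintro s₂ d₂ - ⟨h2, h3⟩ i' hi'
      rcases Nat.lt_succ_iff_lt_or_eq.1 hi' with hi' | rfl
      · exact h2 i' hi'
      · intro j hj
        exact h3 j (by rw [← q0] at hj; exact hj)
  · intro s' _ _ h i hi
    exact h i (by rw [← hn] at hi; exact hi)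

theorem convProg_correct {n r : ℕ} {A : Matrix (Fin n) (Fin n) F} {B₀ : Matrix (Fin r) (Fin r) F}
    {B : Fin n → Matrix (Fin r) (Fin r) F} (hB : ∀ i, (B i).rank = 1)
    (h : diagonalDet A = symbolicDet B₀ B) :
    diagonalDet ((runDet O convProg
      ((blank n r).load 1 (tupleArray B₀ B))).toStore.readMat 2 n) = diagonalDet A := by
  set s : Store F := (blank n r).load 1 (tupleArray B₀ B) with hs
  have hcell0 : ∀ i j : Fin r, s.cell 1 0 i j = B₀ i j := fun i j => by
    simp [hs, Store.load, tupleArray]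
  have hcell : ∀ (l : Fin n) (i j : Fin r), s.cell 1 (l + 1) i j = B l i j := fun l i j => by
    have : (⟨(l : ℕ) + 1, by omega⟩ : Fin (n + 1)) = l.succ := rfl
    simp [hs, Store.load, tupleArray, this]
  -- Array 3 starts out blank, which supplies the zero lower right block of the bordered matrix.
  have haug : augmented s = fun _ _ => 0 := rfl
  have hminor : ∀ l < n, ∀ i < r, ∀ j < r, ∀ k < r, ∀ k' < r,
      s.cell 1 (l + 1) k k' * s.cell 1 (l + 1) i j =
        s.cell 1 (l + 1) k j * s.cell 1 (l + 1) i k' := by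
    intro l hl i hi j hj k hk k' hk'
    obtain ⟨u, v, huv⟩ := exists_eq_vecMulVec_of_rank_eq_one (hB ⟨l, hl⟩)
    have key : ∀ (i : ℕ) (hi : i < r) (j : ℕ) (hj : j < r),
        s.cell 1 (l + 1) i j = u ⟨i, hi⟩ * v ⟨j, hj⟩ := fun i hi j hj => by
      rw [← vecMulVec_apply, ← huv]
      exact hcell ⟨l, hl⟩ ⟨i, hi⟩ ⟨j, hj⟩
    rw [key k hk k' hk', key i hi j hj, key k hk j hj, key i hi k' hk']
    ring
  have hne : ∀ l < n, ∃ i < r, ∃ j < r, s.cell 1 (l + 1) i j ≠ 0 := by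
    intro l hl
    by_contra! h0
    have : B ⟨l, hl⟩ = 0 := by
      ext i j
      rw [← hcell]
      exact h0 i i.2 j j.2
    have hrank := hB ⟨l, hl⟩
    rw [this, rank_zero] at hrank
    exact zero_ne_one hrank
  have hwp : wp O (fun _ => 0) convProg
      (fun s' _ => diagonalDet (s'.readMat 2 n) = diagonalDet A) s 0 := by
    refine wp_seq ((wp_blockProg (r := r) rfl).mono fun s₁ d₁ hA₁ h₁ => ?_)
    have p0 : s₁.reg 0 = n := hA₁.reg 0 (by decide)
    have p1 : s₁.reg 1 = r := hA₁.reg 1 (by decide)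
    have c1 : s₁.cell 1 = s.cell 1 := hA₁.cell 1 (by decide)
    refine wp_seq ((wp_unitProg (m := r + n) (by rw [p0, p1])).mono fun s₂ d₂ hA₂ h₂ => ?_)
    have q0 : s₂.reg 0 = n := (hA₂.reg 0 (by decide)).trans p0
    have q1 : s₂.reg 1 = r := (hA₂.reg 1 (by decide)).trans p1
    have c2 : s₂.cell 1 = s.cell 1 := (hA₂.cell 1 (by decide)).trans c1
    refine wp_seq ((wp_factorsProg q0 q1 (by rwa [c2]) (by rwa [c2])).mono
      fun s₃ d₃ hA₃ h₃ => ?_)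
    have t0 : s₃.reg 0 = n := (hA₃.reg 0 (by decide)).trans q0
    have t1 : s₃.reg 1 = r := (hA₃.reg 1 (by decide)).trans q1
    rw [c2] at h₃
    set g := augmented s₃ with hg
    have hg' : ∀ i j, (i < r ↔ j < r) ∨ r + n ≤ j → g i j =
        if i < r + n ∧ j = r + n + i then 1 else if i < r ∧ j < r then s.cell 1 0 i j else 0 :=
      fun i j hij => by rw [h₃.2 i j hij, h₂, h₁, haug]
    set U : Matrix (Fin r) (Fin n) F := Matrix.of fun i l => g i (r + l) with hU
    set V : Matrix (Fin n) (Fin r) F := Matrix.of fun l j => -g (r + l) j with hV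
    -- The border stores U and -V; the sign in `Factored` accounts for the latter.
    have hBUV : B = fun l => vecMulVec (fun i => U i l) (V l) := by
      funext l
      ext i j
      rw [vecMulVec_apply, ← hcell, h₃.1 l l.2 i i.2 j j.2]
      simp [hU, hV]
    rw [hBUV] at h
    obtain ⟨hdet, hinv⟩ := diagonalDet_toBlocks₂₂_eq h
    set e : Fin r ⊕ Fin n ≃ Fin (r + n) := finSumFinEquiv
    set N : Matrix (Fin (r + n)) (Fin (r + n)) F := Matrix.of fun i j => g i j with hN
    have hNe : N.submatrix e e = fromBlocks B₀ U (-V) 0 := by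
      ext (i | i) (j | j)
      · have hi := i.2
        have hj := j.2
        have h1 := hg' i j (by omega)
        have h2 : ¬ ((i : ℕ) < r + n ∧ (j : ℕ) = r + n + i) := by omega
        rw [if_neg h2, if_pos ⟨hi, hj⟩, hcell0] at h1
        simpa [hN, e] using h1
      · simp [hN, e, hU]
      · simp [hN, e, hV]
      · have hj := j.2
        have h1 := hg' (r + i) (r + j) (by omega)
        have h2 : ¬ (r + (i : ℕ) < r + n ∧ r + (j : ℕ) = r + n + (r + i)) := by omega
        have h3 : ¬ (r + (i : ℕ) < r ∧ r + (j : ℕ) < r) := by omega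
        rw [if_neg h2, if_neg h3] at h1
        simpa [hN, e] using h1
    have hNdet : N.det = 1 := by rw [← det_submatrix_equiv_self e, hNe, hdet]
    have hrow : RowEquivalent N g := by
      refine ⟨?_, by rw [← hN, hNdet]; exact one_ne_zero⟩
      have hone : (Matrix.of fun i j : Fin (r + n) => g i (r + n + j)) = 1 := by
        ext i j
        rw [of_apply, hg' _ _ (Or.inr (by omega)), one_apply]
        have h1 : ¬ ((i : ℕ) < r ∧ r + n + (j : ℕ) < r) := by omega
        have h2 : ((i : ℕ) < r + n ∧ r + n + (j : ℕ) = r + n + i) ↔ i = j := by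
          rw [Fin.ext_iff]
          have := i.2
          omega
        rw [if_neg h1]
        simp only [h2]
      rw [hone, one_mul]
    refine wp_seq ((wp_gaussProg (by rw [t0, t1]) hrow).mono fun s₄ d₄ hA₄ h₄ => ?_)
    have v0 : s₄.reg 0 = n := (hA₄.reg 0 (by decide)).trans t0
    have v1 : s₄.reg 1 = r := (hA₄.reg 1 (by decide)).trans t1
    refine (wp_outputProg v0 v1 rfl).mono fun s₅ d₅ _ h₅ => ?_
    set R : Matrix (Fin (r + n)) (Fin (r + n)) F :=
      Matrix.of fun i j => augmented s₄ i (r + n + j) with hR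
    -- The right half after elimination is a left inverse of the bordered matrix, and its lower
    -- right block is what the output loop copies.
    have hRN : R.submatrix e e * fromBlocks B₀ U (-V) 0 = 1 := by
      rw [← hNe, submatrix_mul_equiv, h₄, submatrix_one_equiv]
    rw [← hinv _ hRN]
    congr 1
    ext i j
    rw [Store.readMat, h₅ i i.2 j j.2]
    simp [toBlocks₂₂, hR, e]
  exact hwp.run

end

end FieldRAM

end

/-! ### The equivalence -/

theorem diagonalDet_eq_symbolicDet {F : Type*} [Field F] {n : ℕ} (A : Matrix (Fin n) (Fin n) F) :
    diagonalDet A = symbolicDet A fun i =>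
      Matrix.vecMulVec (Pi.single i (1 : F)) (Pi.single i 1) := by
  rw [diagonalDet, symbolicDet]
  congr 2
  ext i j
  rw [Matrix.sum_apply, Finset.sum_eq_single i]
  · by_cases h : i = j
    · simp [h, Matrix.vecMulVec_apply]
    · simp [h, Ne.symm h, Matrix.vecMulVec_apply]
  · intro l _ hl
    simp [Matrix.vecMulVec_apply, hl.symm]
  · simp

theorem theorem3p4 :
    -- From learning `det (A₀ + ∑ Aᵢ yᵢ)` with rank-one `Aᵢ` to learning `det (A + Z)`:
    -- randomized preprocessing, evaluation of the new black box, and recovery.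
    (∃ (prep evalP recP : FieldRAM.Prog) (c : ℕ),
      ∀ (F : Type*) [Field F] [DecidableEq F] (n k r : ℕ) (S : Fin (n + 2) ↪ F)
        (A₀ : Matrix (Fin r) (Fin r) F) (A : Fin n → Matrix (Fin r) (Fin r) F),
        1 ≤ n → (∀ i, (A i).rank = 1) →
        (n = 1 → ∀ a : F, symbolicDet A₀ A ≠ MvPolynomial.C a) →
        let f := symbolicDet A₀ A
        let result : (Fin ((n + k + 2) ^ c) → F) → FieldRAM.Config F := fun ω =>
          FieldRAM.run (FieldRAM.boxOf f) (FieldRAM.tape ω) prep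
            ((FieldRAM.blank n k).load 0 (FieldRAM.vecArray S))
        -- the running times, for all outcomes of the random draws
        (∀ w : Fin ((n + k + 2) ^ c) → Fin (n + 2),
          (result (fun i => S (w i))).steps ≤ (n + k + 2) ^ c ∧
          (∀ z : Fin n → F,
            (FieldRAM.runDet (FieldRAM.boxOf f) evalP
              ((result (fun i => S (w i))).toStore.load 1 (FieldRAM.vecArray z))).steps
                ≤ (n + 2) ^ c) ∧
          (∀ A' : Matrix (Fin n) (Fin n) F,
            (FieldRAM.runDet FieldRAM.noBox recP
              ((result (fun i => S (w i))).toStore.load 1 (FieldRAM.matArray A'))).steps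
                ≤ (n + 2) ^ c)) ∧
        -- the probability of success
        1 - 1 / (2 : ℝ) ^ k ≤
          FieldRAM.drawProb S ((n + k + 2) ^ c)
            (fun ω => GoodPreprocessing evalP recP f (result ω).toStore)) ∧
    -- From learning `det (A + Y)` to learning `det (B₀ + ∑ Bᵢ yᵢ)` with rank-one `Bᵢ`:
    -- the black box needs no change, and recovery is deterministic.
    (∀ (F : Type*) [Field F] (n : ℕ) (A : Matrix (Fin n) (Fin n) F),
      ∃ (B₀ : Matrix (Fin n) (Fin n) F) (B : Fin n → Matrix (Fin n) (Fin n) F),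
        (∀ i, (B i).rank = 1) ∧ diagonalDet A = symbolicDet B₀ B) ∧
    (∃ (conv : FieldRAM.Prog) (c : ℕ),
      ∀ (F : Type*) [Field F] [DecidableEq F] (n r : ℕ) (A : Matrix (Fin n) (Fin n) F)
        (B₀ : Matrix (Fin r) (Fin r) F) (B : Fin n → Matrix (Fin r) (Fin r) F),
        (∀ i, (B i).rank = 1) → diagonalDet A = symbolicDet B₀ B →
        let t := FieldRAM.runDet FieldRAM.noBox conv
          ((FieldRAM.blank n r).load 1 (FieldRAM.tupleArray B₀ B))
        t.steps ≤ (n + r + 2) ^ c ∧ diagonalDet (t.toStore.readMat 2 n) = diagonalDet A) := by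
  -- The summand 3 in the exponent makes the random tape long enough for all k(n + 2)n draws.
  refine ⟨⟨FieldRAM.prepProg, FieldRAM.evalProg, FieldRAM.recoverProg,
    FieldRAM.prepProg.deg + FieldRAM.evalProg.deg + FieldRAM.recoverProg.deg + 3, ?_⟩, ?_,
    FieldRAM.convProg, FieldRAM.convProg.deg, ?_⟩
  · intro F _ _ n k r S A₀ A hn hA hone
    set c := FieldRAM.prepProg.deg + FieldRAM.evalProg.deg + FieldRAM.recoverProg.deg + 3 with hc
    intro f result
    have hreg : ∀ ω, (result ω).reg 0 = n := fun ω =>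
      (FieldRAM.exec_agree FieldRAM.prepProg
        ⟨(FieldRAM.blank n k).load 0 (FieldRAM.vecArray S), 0, 0⟩).reg 0 (by decide)
    refine ⟨fun w => ⟨?_, fun z => ?_, fun A' => ?_⟩, ?_⟩
    · refine (FieldRAM.run_steps_le (m := 2) (N := n + k + 2) (by omega) FieldRAM.prepProg
        (by decide) _ fun x hx => ?_).trans (Nat.pow_le_pow_right (by omega) (by omega))
      interval_cases x <;> simp [FieldRAM.blank, FieldRAM.Store.load] <;> omega
    -- With m = 1 only register 0 enters loop bounds, so the bound is free of k, which sits in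
    -- register 1.
    · refine (FieldRAM.run_steps_le (m := 1) (N := n + 2) (by omega) FieldRAM.evalProg
        (by decide) _ fun x hx => ?_).trans (Nat.pow_le_pow_right (by omega) (by omega))
      have h0 : x = 0 := by omega
      have := hreg fun i => S (w i)
      subst h0
      simp only [FieldRAM.Store.load]
      omega
    · refine (FieldRAM.run_steps_le (m := 1) (N := n + 2) (by omega) FieldRAM.recoverProg
        (by decide) _ fun x hx => ?_).trans (Nat.pow_le_pow_right (by omega) (by omega))
      have h0 : x = 0 := by omega
      have := hreg fun i => S (w i)
      subst h0
      simp only [FieldRAM.Store.load]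
      omega
    · refine FieldRAM.le_drawProb_prepProg ?_ (totalDegree_symbolicDet_le hA) S
        fun ω hω => hω.goodPreprocessing hn hA hone
      calc k * (n + 2) * n ≤ (n + k + 2) * (n + k + 2) * (n + k + 2) :=
            Nat.mul_le_mul (Nat.mul_le_mul (by omega) (by omega)) (by omega)
        _ = (n + k + 2) ^ 3 := by ring
        _ ≤ _ := Nat.pow_le_pow_right (by omega) (by omega)
  · intro F _ n A
    exact ⟨A, _, fun i => rank_vecMulVec_eq_one (by simp) (by simp),
      diagonalDet_eq_symbolicDet A⟩
  · intro F _ _ n r A B₀ B hB h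
    refine ⟨?_, FieldRAM.convProg_correct hB h⟩
    refine FieldRAM.run_steps_le (m := 2) (N := n + r + 2) (by omega) FieldRAM.convProg
      (by decide) _ fun x hx => ?_
    interval_cases x <;> simp [FieldRAM.blank, FieldRAM.Store.load] <;> omega
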